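/- Let $u_{i,t}$ ($i\ge 1$, $t\in\mathbb Z$) be real random variables and $f_t$ ($t\in\mathbb Z$) $K$-dimensional random vectors on a probability space $(\Omega,\mathcal B,\mathbb P)$, let $\alpha_i\in\mathbb R$ and $\beta_i\in\mathbb R^K$ be nonrandom, and let $$y_{i,t}=\alpha_i+\beta_i'f_t+u_{i,t}.$$ Write $|X|_\nu=(\mathbb E\|X\|^\nu)^{1/\nu}$. A sequence $(m_t)_{t\in\mathbb Z}$ is an *$\mathcal L_\nu$-decomposable Bernoulli shift* with innovations $(\eta_t)_{t\in\mathbb Z}$, exponent $a>0$ and constant $c>0$ if $(\eta_t)$ is i.i.d. with values in a measurable space $S$; $m_t=g(\eta_t,\eta_{t-1},\dots)$ for a nonrandom measurable $g$; $|m_t|_\nu<\infty$; and $|m_t-m^*_{t,\ell}|_\nu\le c\,\ell^{-a}$ for all $t\in\mathbb Z$ and $\ell\ge 1$, where $m^*_{t,\ell}=g(\eta_t,\dots,\eta_{t-\ell+1},\eta^*_{t-\ell},\eta^*_{t-\ell-1},\dots)$ and $(\eta^*_s)_{s\in\mathbb Z}$ is a copy of $(\eta_s)_{s\in\mathbb Z}$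 independent of it. Assume that, for some $\nu>4$: 1. for each $i$, $(u_{i,t})_t$ is an $\mathcal L_\nu$-decomposable Bernoulli shift with innovations $(\eta^{(i)}_t)_t$ and with exponent $a_u>(\nu-1)/(\nu-2)$ and constant $c_u$ not depending on $i$; moreover $\sup_{i}|u_{i,t}|_\nu<\infty$, $\mathbb E u_{i,t}=0$ and $\inf_i\mathbb E u_{i,t}^2>0$; 2. $(f_t)_t$ is an $\mathcal L_\nu$-decomposable Bernoulli shift with innovations $(\eta^{(f)}_t)_t$, with exponent $a_f>(\nu-1)/(\nu-2)$, and its covariance matrix $\mathcal V(f_t)$ is positive definite; 3. for each $i$, the sequence of pairs $\big(\eta^{(f)}_t,\eta^{(i)}_t\big)_{t\in\mathbb Z}$ is i.i.d. over $t$ (the dependence within a pair, and the dependence across $i$, are unrestricted); 4. $\mathbb E(f_tu_{i,t})=0$ for all $i$ and $t$. For $N,T\ge 1$ let $\bar y_i=T^{-1}\sum_{t=1}^Ty_{i,t}$ and $\bar f=T^{-1}\sum_{t=1}^Tf_t$, and let $$\hat\beta_{i}=\Big[\sum_{t=1}^T(f_t-\bar f)(f_t-\bar f)'\Big]^{-1}\sum_{t=1}^T(f_t-\bar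 f)y_{i,t},\qquad \hat\alpha_i=\bar y_i-\hat\beta_i'\bar f,\qquad \hat u_{i,t}=y_{i,t}-\hat\alpha_i-\hat\beta_i'f_t,$$ $$\hat s_{NT}=\Big(\frac1{NT}\sum_{i=1}^N\sum_{t=1}^T\hat u_{i,t}^2\Big)^{1/2},\qquad \psi_{i,NT}=\Big|\frac{T^{1/\nu}\hat\alpha_i}{\hat s_{NT}}\Big|^{\nu/2},\qquad Z_{N,T}=\max_{1\le i\le N}(\psi_{i,NT}+\omega_i),$$ where $\omega_1,\omega_2,\dots$ are i.i.d. $N(0,1)$ and, for all $N$ and $T$, $(\omega_1,\dots,\omega_N)$ is independent of the sample $\{(u_{i,t},f_t):1\le i\le N,\,1\le t\le T\}$. Let $\mathbb P^*$ be the (regular) conditional probability given this sample, and let $$b_N=\sqrt{2\log N}-\frac{\log\log N+\log(4\pi)}{2\sqrt{2\log N}},\qquad a_N=\frac{b_N}{1+b_N^2}.$$ Fix $\varepsilon>0$ and a constant $C$. All limits below are taken as $\min\{N,T\}\to\infty$ over the pairs $(N,T)$ with $N\le C\,T^{\frac12(\frac\nu2-1)-\varepsilon}$, jointly in $N$ and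 $T$. (a) If $\alpha_i=0$ for all $i$ (hypothesis $\mathbb H_0$), then for almost every realization of the sample and all $x\in\mathbb R$, $$\lim\ \mathbb P^*\Big(\frac{Z_{N,T}-b_N}{a_N}\le x\Big)=\exp(-e^{-x}).$$ (b) If $\alpha_i\ne0$ for at least one $i$ (hypothesis $\mathbb H_A$), then for almost every realization of the sample and all $x\in\mathbb R$, $$\lim\ \mathbb P^*\Big(\frac{Z_{N,T}-b_N}{a_N}\le x\Big)=0.$$ -/

import Mathlib

open MeasureTheory ProbabilityTheory Filter Topology
open scoped ENNReal NNReal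

/-- `ζ` is a two-sided i.i.d. sequence of random elements of the measurable space `S`. -/
structure IsIIDSeq {Ω S : Type*} [MeasurableSpace Ω] [MeasurableSpace S] (P : Measure Ω)
    (ζ : ℤ → Ω → S) : Prop where
  measurable : ∀ t, Measurable (ζ t)
  indep : iIndepFun ζ P
  identDistrib : ∀ t, IdentDistrib (ζ t) (ζ 0) P P

/-- The innovations `(η_t, η_{t-1}, η_{t-2}, …)` up to time `t`. -/
def innovationPast {Ω S : Type*} (η : ℤ → Ω → S) (t : ℤ) (ω : Ω) : ℕ → S :=
  fun k => η (t - (k : ℤ)) ω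

/-- The coupled innovations `(η_t, …, η_{t-ℓ+1}, η*_{t-ℓ}, η*_{t-ℓ-1}, …)`. They live on `Ω × Ω`,
to be equipped with the product measure `P.prod P`: the first coordinate carries `η`, the second
one carries the copy `η*`, which therefore is independent of `η` and has the same law. -/
def coupledPast {Ω S : Type*} (η : ℤ → Ω → S) (t : ℤ) (ℓ : ℕ) (q : Ω × Ω) : ℕ → S :=
  fun k => if k < ℓ then η (t - (k : ℤ)) q.1 else η (t - (k : ℤ)) q.2

/-- `m` is an `L_ν`-decomposable Bernoulli shift driven by the innovations `η`, with decay
exponent `a` and constant `c`: `m_t = g (η_t, η_{t-1}, …)` with `η` i.i.d., `|m_t|_ν < ∞` and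
`|m_t - m*_{t,ℓ}|_ν ≤ c ℓ^{-a}` for all `ℓ ≥ 1`. -/
structure IsDecomposableShift {Ω S E : Type*} [MeasurableSpace Ω] [MeasurableSpace S]
    [NormedAddCommGroup E] [MeasurableSpace E] (P : Measure Ω) (η : ℤ → Ω → S)
    (m : ℤ → Ω → E) (ν a c : ℝ) : Prop where
  a_pos : 0 < a
  c_pos : 0 < c
  iid : IsIIDSeq P η
  memLp : ∀ t, MemLp (m t) (ENNReal.ofReal ν) P
  exists_shift : ∃ g : (ℕ → S) → E, Measurable g ∧
    (∀ t ω, m t ω = g (innovationPast η t ω)) ∧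
    ∀ (t : ℤ) (ℓ : ℕ), 1 ≤ ℓ →
      eLpNorm (fun q : Ω × Ω => g (innovationPast η t q.1) - g (coupledPast η t ℓ q))
        (ENNReal.ofReal ν) (P.prod P) ≤ ENNReal.ofReal (c * (ℓ : ℝ) ^ (-a))

/-- The covariance matrix of a random vector. -/
noncomputable def covMatrix {Ω : Type*} [MeasurableSpace Ω] {K : ℕ} (P : Measure Ω)
    (X : Ω → EuclideanSpace ℝ (Fin K)) : Matrix (Fin K) (Fin K) ℝ :=
  Matrix.of fun k l => cov[fun ω => X ω k, fun ω => X ω l; P]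

/-! ### The factor model and its unit-by-unit OLS estimation

The estimators are functions of the observed paths. Units are numbered `0, 1, 2, …`, so that the
first `N` units are those in `Finset.range N`; the observation times are `1, …, T`. -/

/-- The returns `y_{i,t} = α_i + β_i' f_t + u_{i,t}`. -/
def returns {K : ℕ} (α : ℕ → ℝ) (β : ℕ → Fin K → ℝ) (f : ℤ → EuclideanSpace ℝ (Fin K))
    (u : ℕ → ℤ → ℝ) (i : ℕ) (t : ℤ) : ℝ :=
  α i + ∑ k, β i k * f t k + u i t

/-- The sample mean over the times `1, …, T`. -/
noncomputable def timeMean (T : ℕ) (z : ℤ → ℝ) : ℝ :=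
  (T : ℝ)⁻¹ * ∑ t ∈ Finset.Icc (1 : ℤ) T, z t

/-- The sample mean of the factors. -/
noncomputable def factorMean {K : ℕ} (T : ℕ) (f : ℤ → EuclideanSpace ℝ (Fin K)) : Fin K → ℝ :=
  fun k => timeMean T (fun t => f t k)

/-- The matrix `∑ t, (f_t - f̄) (f_t - f̄)'`. -/
noncomputable def factorScatter {K : ℕ} (T : ℕ) (f : ℤ → EuclideanSpace ℝ (Fin K)) :
    Matrix (Fin K) (Fin K) ℝ :=
  Matrix.of fun k l => ∑ t ∈ Finset.Icc (1 : ℤ) T,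
    (f t k - factorMean T f k) * (f t l - factorMean T f l)

/-- The OLS estimator of the loadings from the time series `y` of one unit. -/
noncomputable def betaHat {K : ℕ} (T : ℕ) (f : ℤ → EuclideanSpace ℝ (Fin K)) (y : ℤ → ℝ) :
    Fin K → ℝ :=
  Matrix.mulVec (factorScatter T f)⁻¹
    (fun k => ∑ t ∈ Finset.Icc (1 : ℤ) T, (f t k - factorMean T f k) * y t)

/-- The OLS estimator of alpha, `ȳ - β̂' f̄`. -/
noncomputable def alphaHat {K : ℕ} (T : ℕ) (f : ℤ → EuclideanSpace ℝ (Fin K)) (y : ℤ → ℝ) : ℝ :=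
  timeMean T y - ∑ k, betaHat T f y k * factorMean T f k

/-- The OLS residual at time `t`. -/
noncomputable def olsResidual {K : ℕ} (T : ℕ) (f : ℤ → EuclideanSpace ℝ (Fin K)) (y : ℤ → ℝ)
    (t : ℤ) : ℝ :=
  y t - alphaHat T f y - ∑ k, betaHat T f y k * f t k

/-- The rescaling sequence: the root of the average squared OLS residual over all units and
times. -/
noncomputable def sHat {K : ℕ} (N T : ℕ) (f : ℤ → EuclideanSpace ℝ (Fin K))
    (y : ℕ → ℤ → ℝ) : ℝ :=
  √(((N : ℝ) * (T : ℝ))⁻¹ *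
    ∑ i ∈ Finset.range N, ∑ t ∈ Finset.Icc (1 : ℤ) T, olsResidual T f (y i) t ^ 2)

/-- `ψ_{i,NT} = |T^{1/ν} α̂_i / ŝ_{NT}|^{ν/2}`. -/
noncomputable def psiStat {K : ℕ} (ν : ℝ) (N T : ℕ) (f : ℤ → EuclideanSpace ℝ (Fin K))
    (y : ℕ → ℤ → ℝ) (i : ℕ) : ℝ :=
  |(T : ℝ) ^ (1 / ν) * alphaHat T f (y i) / sHat N T f y| ^ (ν / 2)

/-- `Z_{N,T}`, the maximum over the first `N` units of `ψ_{i,NT} + w_i`. -/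
noncomputable def maxStat {K : ℕ} (ν : ℝ) (N T : ℕ) (f : ℤ → EuclideanSpace ℝ (Fin K))
    (y : ℕ → ℤ → ℝ) (w : ℕ → ℝ) : ℝ :=
  ⨆ i : Fin N, (psiStat ν N T f y i + w i)

/-- The centring `b_N`. -/
noncomputable def gumbelB (N : ℕ) : ℝ :=
  √(2 * Real.log N) -
    (Real.log (Real.log N) + Real.log (4 * Real.pi)) / (2 * √(2 * Real.log N))

/-- The scaling `a_N`. -/
noncomputable def gumbelA (N : ℕ) : ℝ :=
  gumbelB N / (1 + gumbelB N ^ 2)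

/-- The sample `{(u_{i,t}, f_t) : i` among the first `N` units, `1 ≤ t ≤ T}`. -/
def sampleNT {Ω : Type*} {K : ℕ} (f : ℤ → Ω → EuclideanSpace ℝ (Fin K)) (u : ℕ → ℤ → Ω → ℝ)
    (N T : ℕ) (ω : Ω) :
    (Fin N → Set.Icc (1 : ℤ) (T : ℤ) → ℝ) ×
      (Set.Icc (1 : ℤ) (T : ℤ) → EuclideanSpace ℝ (Fin K)) :=
  (fun i t => u i t ω, fun t => f t ω)

/-- The normalised statistic `(Z_{N,T} - b_N) / a_N` as a random variable. -/
noncomputable def normalizedStat {Ω : Type*} {K : ℕ} (ν : ℝ) (α : ℕ → ℝ) (β : ℕ → Fin K → ℝ)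
    (f : ℤ → Ω → EuclideanSpace ℝ (Fin K)) (u : ℕ → ℤ → Ω → ℝ) (w : ℕ → Ω → ℝ)
    (N T : ℕ) (ω : Ω) : ℝ :=
  (maxStat ν N T (fun t => f t ω) (returns α β (fun t => f t ω) (fun i t => u i t ω))
    (fun i => w i ω) - gumbelB N) / gumbelA N

/-- `P*((Z_{N,T} - b_N) / a_N ≤ x)` at the realization `ω`: the (regular) conditional
probability given the sample. -/
noncomputable def condCDFStat {Ω : Type*} [MeasurableSpace Ω] {K : ℕ} (P : Measure Ω)
    [IsFiniteMeasure P] (ν : ℝ) (α : ℕ → ℝ) (β : ℕ → Fin K → ℝ)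
    (f : ℤ → Ω → EuclideanSpace ℝ (Fin K)) (u : ℕ → ℤ → Ω → ℝ) (w : ℕ → Ω → ℝ)
    (N T : ℕ) (x : ℝ) (ω : Ω) : ℝ :=
  (condDistrib (normalizedStat ν α β f u w N T) (sampleNT f u N T) P
    (sampleNT f u N T ω)).real (Set.Iic x)

/-- `min {N, T} → ∞` among the pairs `(N, T)` with `N ≤ C T^{(ν/2 - 1)/2 - ε}`. -/
noncomputable def jointLimit (ν ε C : ℝ) : Filter (ℕ × ℕ) :=
  (atTop ×ˢ atTop) ⊓
    𝓟 {p : ℕ × ℕ | (p.1 : ℝ) ≤ C * (p.2 : ℝ) ^ ((1 / 2 : ℝ) * (ν / 2 - 1) - ε)}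

/-!
Conditionally on the sample, `Z_{N,T}` is the maximum of `N` independent normal variables with unit
variance and means `ψ_{i,NT}`, so that `P*((Z - b_N) / a_N ≤ x) = ∏ i, Φ(b_N + a_N x - ψ_{i,NT})`
(`ae_condCDFStat_eq`). Without the means this is `Φ(b_N + a_N x) ^ N`, which tends to
`exp (-e^{-x})` by Mills' ratio (`tendsto_normalCDF_pow`). It remains to show that almost surely the
`ψ_{i,NT}` are uniformly `o(a_N)` if all alphas vanish, and that one of them is of larger order than
`b_N` otherwise. As `N` is at most a power of `T`, both `1 / a_N` and `b_N` are of order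
`√(2 log N)`, which is negligible against any power of `T`.

The estimation errors are functions of time averages of `u_i`, `f_k u_i`, `u_i ^ 2`, `f_k` and
`f_k f_l` (`exists_leastSquares_bounds`). Each of these processes is a decomposable shift in
`L^p`, `p = ν / 2 > 2`, with decay exponent above `1` (`IsDecomposableShift.mul`). For such a shift
two adjacent blocks of any length are independent up to a bounded error in `L^p`: replace the
innovations that precede the second block by their independent copy
(`IsDecomposableShift.hasDecoupledBlocks`). Doubling the block length repeatedly then gives
`‖∑_{t ≤ n} x_t‖_p = O(√n)` along `n = 2 ^ k`, first for `p = 2` by orthogonality and then from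
`p / 2` to `p`, because the power `p` of a sum of two independent variables is nearly the sum of
the powers and `2 ^ (1 / p) < √2` (`HasDecoupledBlocks.exists_eLpNorm_le`). The same inequality
makes dyadic chaining lossless, so that the running maximum is `O(√n)` as well
(`exists_maximal_le`).

A union bound over the units and summation over dyadic ranges of `T` turn this into an almost sure
rate `T ^ (-δ)` uniformly over `i < N` as long as `N = O(T ^ θ)` with `θ + p δ < p / 2`
(`ae_exists_abs_timeMean_le`). For `θ = (p - 1) / 2 - ε` the choice `δ = (1 + ε) / ν` is
admissible, and then `ψ_{i,NT}`, which under the null hypothesis is of the order of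
`T ^ (1 / 2) * |α̂_i| ^ p`, is `O(T ^ (-ε / 2))`. If `α_i ≠ 0`, then `α̂_i` tends to `α_i` and
`ψ_{i,NT}` is at least of order `T ^ (1 / 2)`.
-/

/-! ### Decomposable shifts: stationarity, closure properties and decoupling -/

section Shifts

variable {Ω S : Type*} [MeasurableSpace Ω] [MeasurableSpace S] {P : Measure Ω} {η : ℤ → Ω → S}

theorem IsIIDSeq.measurable_innovationPast (hη : IsIIDSeq P η) (t : ℤ) :
    Measurable (innovationPast η t) :=
  measurable_pi_iff.2 fun _ => hη.measurable _

theorem IsIIDSeq.measurable_coupledPast (hη : IsIIDSeq P η) (t : ℤ) (ℓ : ℕ) :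
    Measurable (coupledPast η t ℓ) := by
  refine measurable_pi_iff.2 fun k => ?_
  unfold coupledPast
  split_ifs
  · exact (hη.measurable _).comp measurable_fst
  · exact (hη.measurable _).comp measurable_snd

theorem IsIIDSeq.map_innovationPast (hη : IsIIDSeq P η) (t : ℤ) :
    P.map (innovationPast η t) = Measure.infinitePi (fun _ : ℕ => P.map (η 0)) := by
  have hinj : Function.Injective (fun k : ℕ => t - (k : ℤ)) := by
    intro a b h
    simpa using h
  have h := (hη.indep.precomp hinj).map_fun_eq_infinitePi_map (fun k => hη.measurable _)
  change P.map (fun ω (k : ℕ) => η (t - (k : ℤ)) ω) = _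
  rw [h]
  congr 1
  funext k
  exact (hη.identDistrib _).map_eq

theorem IsIIDSeq.identDistrib_innovationPast (hη : IsIIDSeq P η) (t : ℤ) :
    IdentDistrib (innovationPast η t) (innovationPast η 0) P P where
  aemeasurable_fst := (hη.measurable_innovationPast t).aemeasurable
  aemeasurable_snd := (hη.measurable_innovationPast 0).aemeasurable
  map_eq := by rw [hη.map_innovationPast, hη.map_innovationPast]

/-- Innovations before time `m` are independent of innovations from time `m` on, even if the
latter are supplemented by the independent copy that lives on the second factor of `Ω × Ω`. -/
theorem IsIIDSeq.indepFun_fst_of_measurable [IsProbabilityMeasure P] (hη : IsIIDSeq P η) (m : ℤ)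
    {A : Ω → ℝ} {B : Ω × Ω → ℝ}
    (hA : Measurable[⨆ j ∈ Set.Iio m, (inferInstance : MeasurableSpace S).comap (η j)] A)
    (hB : Measurable B)
    (hB' : ∀ ω', Measurable[⨆ j ∈ Set.Ici m, (inferInstance : MeasurableSpace S).comap (η j)]
      (fun ω => B (ω, ω'))) :
    IndepFun (fun q : Ω × Ω => A q.1) B (P.prod P) := by
  have hle : ∀ j, (inferInstance : MeasurableSpace S).comap (η j) ≤ ‹MeasurableSpace Ω› :=
    fun j => (hη.measurable j).comap_le
  have hAm : Measurable A := hA.mono (iSup₂_le fun j _ => hle j) le_rfl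
  have hind : Indep (⨆ j ∈ Set.Iio m, (inferInstance : MeasurableSpace S).comap (η j))
      (⨆ j ∈ Set.Ici m, (inferInstance : MeasurableSpace S).comap (η j)) P :=
    indep_iSup_of_disjoint hle hη.indep.iIndep
      (Set.disjoint_left.2 fun j h1 h2 => (Set.mem_Iio.1 h1).not_ge h2)
  rw [indepFun_iff_measure_inter_preimage_eq_mul]
  intro s t hs ht
  have hAs : MeasurableSet ((fun q : Ω × Ω => A q.1) ⁻¹' s) :=
    (hAm.comp measurable_fst) hs
  rw [Measure.prod_apply_symm (hAs.inter (hB ht)), Measure.prod_apply_symm (hB ht)]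
  have h1 : (P.prod P) ((fun q : Ω × Ω => A q.1) ⁻¹' s) = P (A ⁻¹' s) := by
    have : (fun q : Ω × Ω => A q.1) ⁻¹' s = (A ⁻¹' s) ×ˢ Set.univ := by ext; simp
    rw [this, Measure.prod_prod]; simp
  rw [h1, ← lintegral_const_mul]
  · refine lintegral_congr fun ω' => ?_
    have := (Indep_iff _ _ P).1 hind (A ⁻¹' s) ((fun ω => B (ω, ω')) ⁻¹' t) (hA hs) (hB' ω' ht)
    exact this
  · exact measurable_measure_prodMk_right (hB ht)

end Shifts

/-! ### Moments of sums of two independent variables -/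

section Moments

variable {Ω : Type*} [MeasurableSpace Ω] {P : Measure Ω}

theorem eLpNorm_ofReal_rpow {p : ℝ} (hp : 0 < p) (f : Ω → ℝ) :
    eLpNorm f (ENNReal.ofReal p) P ^ p = ∫⁻ ω, ‖f ω‖ₑ ^ p ∂P := by
  rw [eLpNorm_eq_lintegral_rpow_enorm_toReal (by simpa using hp) ENNReal.ofReal_ne_top,
    ENNReal.toReal_ofReal hp.le, ← ENNReal.rpow_mul, one_div, inv_mul_cancel₀ hp.ne',
    ENNReal.rpow_one]

theorem eLpNorm_two_add_le_of_indepFun [IsProbabilityMeasure P] {A B : Ω → ℝ} (hA : Measurable A)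
    (hB : Measurable B) (hAB : IndepFun A B P) (hA0 : ∫ ω, A ω ∂P = 0) {m m' : ℝ} (hm : 0 ≤ m)
    (hm' : 0 ≤ m') (hAm : eLpNorm A 2 P ≤ ENNReal.ofReal m)
    (hBm : eLpNorm B 2 P ≤ ENNReal.ofReal m') :
    eLpNorm (A + B) 2 P ≤ ENNReal.ofReal √(m ^ 2 + m' ^ 2) := by
  have hA2 : MemLp A 2 P := ⟨hA.aestronglyMeasurable, hAm.trans_lt ENNReal.ofReal_lt_top⟩
  have hB2 : MemLp B 2 P := ⟨hB.aestronglyMeasurable, hBm.trans_lt ENNReal.ofReal_lt_top⟩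
  have key : ∀ f : Ω → ℝ, MemLp f 2 P → eLpNorm f 2 P = ENNReal.ofReal √(∫ ω, f ω ^ 2 ∂P) := by
    intro f hf
    rw [hf.eLpNorm_eq_integral_rpow_norm (by simp) (by simp)]
    simp [Real.sqrt_eq_rpow]
  have hle : ∀ (f : Ω → ℝ) (r : ℝ), 0 ≤ r → MemLp f 2 P → eLpNorm f 2 P ≤ ENNReal.ofReal r →
      ∫ ω, f ω ^ 2 ∂P ≤ r ^ 2 := by
    intro f r hr hf h
    rw [key f hf, ENNReal.ofReal_le_ofReal_iff hr] at h
    exact (Real.sqrt_le_left hr).1 h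
  rw [key _ (hA2.add hB2)]
  refine ENNReal.ofReal_le_ofReal (Real.sqrt_le_sqrt ?_)
  have hmul : ∫ ω, A ω * B ω ∂P = 0 := by
    rw [hAB.integral_fun_mul_eq_mul_integral hA.aestronglyMeasurable hB.aestronglyMeasurable,
      hA0, zero_mul]
  have hexp : ∫ ω, (A + B) ω ^ 2 ∂P = ∫ ω, A ω ^ 2 ∂P + ∫ ω, B ω ^ 2 ∂P := by
    have : ∀ ω, (A + B) ω ^ 2 = A ω ^ 2 + 2 * (A ω * B ω) + B ω ^ 2 := by
      intro ω; simp only [Pi.add_apply]; ring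
    have hiAB : Integrable (fun ω => A ω * B ω) P := hA2.integrable_mul hB2
    have hi : Integrable (fun ω => A ω ^ 2 + 2 * (A ω * B ω)) P :=
      hA2.integrable_sq.add (hiAB.const_mul 2)
    simp_rw [this]
    rw [integral_add hi hB2.integrable_sq,
      integral_add hA2.integrable_sq (hiAB.const_mul 2), integral_const_mul, hmul]
    ring
  rw [hexp]
  exact add_le_add (hle A m hm hA2 hAm) (hle B m' hm' hB2 hBm)

/-- The power of a sum is almost the sum of the powers, except where the two summands are
comparable, and there it is dominated by a product. -/
theorem NNReal.add_rpow_le_of_comparable {p : ℝ} (hp : 0 < p) {κ : ℝ≥0} (hκ : 0 < κ) (a b : ℝ≥0) :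
    (a + b) ^ p ≤ (1 + κ) ^ p * (a ^ p + b ^ p) +
      (1 + κ⁻¹) ^ p * (a ^ (p / 2) * b ^ (p / 2)) := by
  rcases le_total b (κ * a) with h1 | h1
  · have h : a + b ≤ (1 + κ) * a := by rw [add_mul, one_mul]; gcongr
    calc (a + b) ^ p ≤ ((1 + κ) * a) ^ p := by gcongr
      _ = (1 + κ) ^ p * a ^ p := NNReal.mul_rpow ..
      _ ≤ (1 + κ) ^ p * (a ^ p + b ^ p) := by gcongr; exact le_self_add
      _ ≤ _ := le_self_add
  rcases le_total a (κ * b) with h2 | h2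
  · have h : a + b ≤ (1 + κ) * b := by rw [add_mul, one_mul, add_comm]; gcongr
    calc (a + b) ^ p ≤ ((1 + κ) * b) ^ p := by gcongr
      _ = (1 + κ) ^ p * b ^ p := NNReal.mul_rpow ..
      _ ≤ (1 + κ) ^ p * (a ^ p + b ^ p) := by gcongr; exact le_add_self
      _ ≤ _ := le_self_add
  have h1' : a ≤ κ⁻¹ * b := by
    rw [inv_mul_eq_div, le_div_iff₀ hκ, mul_comm]; exact h1
  have h2' : b ≤ κ⁻¹ * a := by
    rw [inv_mul_eq_div, le_div_iff₀ hκ, mul_comm]; exact h2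
  have ha : a + b ≤ (1 + κ⁻¹) * a := by rw [add_mul, one_mul]; gcongr
  have hb : a + b ≤ (1 + κ⁻¹) * b := by rw [add_mul, one_mul, add_comm]; gcongr
  refine le_trans ?_ le_add_self
  have hsplit : ∀ z : ℝ≥0, z ^ p = z ^ (p / 2) * z ^ (p / 2) := fun z => by
    rw [← NNReal.rpow_add_of_nonneg _ (by positivity) (by positivity), add_halves]
  calc (a + b) ^ p = (a + b) ^ (p / 2) * (a + b) ^ (p / 2) := hsplit _
    _ ≤ ((1 + κ⁻¹) * a) ^ (p / 2) * ((1 + κ⁻¹) * b) ^ (p / 2) := by gcongr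
    _ = _ := by rw [NNReal.mul_rpow, NNReal.mul_rpow, hsplit (1 + κ⁻¹)]; ring

/-- For independent variables the `L^p` norm of the sum exceeds that of the summands by a factor
just above `2 ^ (1 / p)`, up to an error in terms of moments of order `p / 2`. For `p > 2` that
factor can be taken below `√2`. -/
theorem eLpNorm_add_le_of_indepFun {p : ℝ} (hp : 2 ≤ p) {κ : ℝ≥0} (hκ : 0 < κ)
    {A B : Ω → ℝ} (hA : Measurable A) (hB : Measurable B) (hAB : IndepFun A B P) {m d : ℝ}
    (hm : 0 ≤ m) (hd : 0 ≤ d)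
    (hAm : eLpNorm A (ENNReal.ofReal p) P ≤ ENNReal.ofReal m)
    (hBm : eLpNorm B (ENNReal.ofReal p) P ≤ ENNReal.ofReal m)
    (hAd : eLpNorm A (ENNReal.ofReal (p / 2)) P ≤ ENNReal.ofReal d)
    (hBd : eLpNorm B (ENNReal.ofReal (p / 2)) P ≤ ENNReal.ofReal d) :
    eLpNorm (A + B) (ENNReal.ofReal p) P ≤
      ENNReal.ofReal ((1 + κ) * 2 ^ (1 / p) * m + (1 + (κ : ℝ)⁻¹) * d) := by
  have hp0 : 0 < p := by linarith
  have hpw : ∀ x y : ℝ, ‖x + y‖ₑ ^ p ≤ ((1 + κ : ℝ≥0) : ℝ≥0∞) ^ p * (‖x‖ₑ ^ p + ‖y‖ₑ ^ p) +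
      ((1 + κ⁻¹ : ℝ≥0) : ℝ≥0∞) ^ p * (‖x‖ₑ ^ (p / 2) * ‖y‖ₑ ^ (p / 2)) := by
    intro x y
    have h := (NNReal.rpow_le_rpow (nnnorm_add_le x y) hp0.le).trans
      (NNReal.add_rpow_le_of_comparable hp0 hκ ‖x‖₊ ‖y‖₊)
    have h' := ENNReal.coe_le_coe.2 h
    simp only [ENNReal.coe_add, ENNReal.coe_mul,
      ENNReal.coe_rpow_of_nonneg _ hp0.le,
      ENNReal.coe_rpow_of_nonneg _ (by positivity : (0 : ℝ) ≤ p / 2)] at h' ⊢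
    exact h'
  have hsum : eLpNorm (A + B) (ENNReal.ofReal p) P ^ p ≤
      ((1 + κ : ℝ≥0) : ℝ≥0∞) ^ p * (ENNReal.ofReal m ^ p + ENNReal.ofReal m ^ p) +
      ((1 + κ⁻¹ : ℝ≥0) : ℝ≥0∞) ^ p *
        (ENNReal.ofReal d ^ (p / 2) * ENNReal.ofReal d ^ (p / 2)) := by
    rw [eLpNorm_ofReal_rpow hp0]
    have hAe : ∀ r : ℝ, Measurable fun ω => ‖A ω‖ₑ ^ r := fun r => hA.enorm.pow_const r
    have hBe : ∀ r : ℝ, Measurable fun ω => ‖B ω‖ₑ ^ r := fun r => hB.enorm.pow_const r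
    refine (lintegral_mono fun ω => hpw (A ω) (B ω)).trans ?_
    have hs : Measurable fun ω => ‖A ω‖ₑ ^ p + ‖B ω‖ₑ ^ p := (hAe p).add (hBe p)
    have hml : Measurable fun ω => ‖A ω‖ₑ ^ (p / 2) * ‖B ω‖ₑ ^ (p / 2) := (hAe _).mul (hBe _)
    rw [lintegral_add_left (hs.const_mul _), lintegral_const_mul _ hs, lintegral_add_left (hAe p),
      lintegral_const_mul _ hml,
      lintegral_mul_eq_lintegral_mul_lintegral_of_indepFun'' (hAe _).aemeasurable
        (hBe _).aemeasurable (hAB.comp (φ := fun z => ‖z‖ₑ ^ (p / 2))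
          (ψ := fun z => ‖z‖ₑ ^ (p / 2)) (by fun_prop) (by fun_prop)),
      ← eLpNorm_ofReal_rpow hp0, ← eLpNorm_ofReal_rpow hp0,
      ← eLpNorm_ofReal_rpow (by positivity : 0 < p / 2),
      ← eLpNorm_ofReal_rpow (by positivity : 0 < p / 2)]
    gcongr
  have hroot := ENNReal.rpow_le_rpow hsum (by positivity : (0 : ℝ) ≤ 1 / p)
  rw [← ENNReal.rpow_mul, mul_one_div_cancel hp0.ne', ENNReal.rpow_one] at hroot
  refine hroot.trans ((ENNReal.rpow_add_le_add_rpow _ _ (by positivity)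
    (by rw [div_le_one hp0]; linarith)).trans (le_of_eq ?_))
  have hpc : ∀ z : ℝ≥0∞, (z ^ p) ^ (1 / p) = z := fun z => by
    rw [← ENNReal.rpow_mul, mul_one_div_cancel hp0.ne', ENNReal.rpow_one]
  rw [← two_mul, ENNReal.mul_rpow_of_nonneg _ _ (by positivity : (0 : ℝ) ≤ 1 / p),
    ENNReal.mul_rpow_of_nonneg _ _ (by positivity : (0 : ℝ) ≤ 1 / p),
    ENNReal.mul_rpow_of_nonneg _ _ (by positivity : (0 : ℝ) ≤ 1 / p),
    ← ENNReal.rpow_add_of_nonneg _ _ (by positivity : (0 : ℝ) ≤ p / 2)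
      (by positivity : (0 : ℝ) ≤ p / 2), add_halves, hpc, hpc, hpc, hpc,
    ENNReal.ofReal_add (by positivity) (by positivity), ENNReal.ofReal_mul (by positivity),
    ENNReal.ofReal_mul (by positivity), ENNReal.ofReal_mul (by positivity)]
  have e1 : ((1 + κ : ℝ≥0) : ℝ≥0∞) = ENNReal.ofReal (1 + κ) := by
    rw [← ENNReal.ofReal_coe_nnreal]; simp
  have e2 : ((1 + κ⁻¹ : ℝ≥0) : ℝ≥0∞) = ENNReal.ofReal (1 + (κ : ℝ)⁻¹) := by
    rw [← ENNReal.ofReal_coe_nnreal]; simp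
  have e3 : (2 : ℝ≥0∞) ^ (1 / p) = ENNReal.ofReal (2 ^ (1 / p)) := by
    rw [← ENNReal.ofReal_rpow_of_pos (by norm_num)]; simp
  rw [e1, e2, e3, mul_assoc]

theorem eLpNorm_max_le {p : ℝ} (hp : 2 ≤ p) {F G : Ω → ℝ} (hF : Measurable F) {m : ℝ}
    (hFm : eLpNorm F (ENNReal.ofReal p) P ≤ ENNReal.ofReal m)
    (hGm : eLpNorm G (ENNReal.ofReal p) P ≤ ENNReal.ofReal m) :
    eLpNorm (fun ω => max (F ω) (G ω)) (ENNReal.ofReal p) P ≤ ENNReal.ofReal (2 ^ (1 / p) * m) := by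
  have hp0 : 0 < p := by linarith
  have hsum : eLpNorm (fun ω => max (F ω) (G ω)) (ENNReal.ofReal p) P ^ p ≤
      2 * ENNReal.ofReal m ^ p := by
    rw [eLpNorm_ofReal_rpow hp0]
    have : ∀ ω, ‖max (F ω) (G ω)‖ₑ ^ p ≤ ‖F ω‖ₑ ^ p + ‖G ω‖ₑ ^ p := by
      intro ω
      rcases max_choice (F ω) (G ω) with h | h <;> rw [h]
      · exact le_self_add
      · exact le_add_self
    refine (lintegral_mono this).trans ?_
    rw [lintegral_add_left (hF.enorm.pow_const p), ← eLpNorm_ofReal_rpow hp0,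
      ← eLpNorm_ofReal_rpow hp0, two_mul]
    gcongr
  have hroot := ENNReal.rpow_le_rpow hsum (by positivity : (0 : ℝ) ≤ 1 / p)
  rw [← ENNReal.rpow_mul, mul_one_div_cancel hp0.ne', ENNReal.rpow_one,
    ENNReal.mul_rpow_of_nonneg _ _ (by positivity : (0 : ℝ) ≤ 1 / p), ← ENNReal.rpow_mul,
    mul_one_div_cancel hp0.ne', ENNReal.rpow_one] at hroot
  refine hroot.trans (le_of_eq ?_)
  rw [ENNReal.ofReal_mul (by positivity), ← ENNReal.ofReal_rpow_of_pos (by norm_num)]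
  simp

end Moments

/-! ### Block sums of decoupled processes -/

section Blocks

/-- The sum of `x` over the `n` consecutive times `s, …, s + n - 1`. -/
def blockSum {Ω : Type*} (x : ℤ → Ω → ℝ) (s : ℤ) (n : ℕ) (ω : Ω) : ℝ :=
  ∑ j ∈ Finset.range n, x (s + (j : ℤ)) ω

theorem blockSum_add {Ω : Type*} (x : ℤ → Ω → ℝ) (s : ℤ) (m n : ℕ) (ω : Ω) :
    blockSum x s (m + n) ω = blockSum x s m ω + blockSum x (s + m) n ω := by
  simp only [blockSum, Finset.sum_range_add]
  congr 1
  refine Finset.sum_congr rfl fun j _ => ?_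
  rw [Nat.cast_add, add_assoc]

variable {Ω : Type*} [MeasurableSpace Ω] {P : Measure Ω}

/-- Any block sum of `x` is, within a fixed distance `c` in `L^p`, independent of the adjacent
preceding block sum of the same length. The independent approximation is a random variable on
`Ω × Ω`, the second factor of which carries the additional randomness. -/
structure HasDecoupledBlocks (P : Measure Ω) (x : ℤ → Ω → ℝ) (p c : ℝ) : Prop where
  measurable : ∀ t, Measurable (x t)
  exists_indepFun : ∀ (s : ℤ) (n : ℕ), ∃ B : Ω × Ω → ℝ, Measurable B ∧
    IndepFun (fun q => blockSum x s n q.1) B (P.prod P) ∧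
    eLpNorm (fun q => blockSum x (s + n) n q.1 - B q) (ENNReal.ofReal p) (P.prod P) ≤
      ENNReal.ofReal c

theorem HasDecoupledBlocks.mono_exponent [IsProbabilityMeasure P] {x : ℤ → Ω → ℝ} {p c : ℝ}
    (hx : HasDecoupledBlocks P x p c) {q : ℝ} (hqp : q ≤ p) : HasDecoupledBlocks P x q c where
  measurable := hx.measurable
  exists_indepFun := by
    intro s n
    obtain ⟨B, hB, hind, hle⟩ := hx.exists_indepFun s n
    refine ⟨B, hB, hind, le_trans ?_ hle⟩
    refine eLpNorm_le_eLpNorm_of_exponent_le (ENNReal.ofReal_le_ofReal hqp) ?_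
    have : ∀ s, Measurable (blockSum x s n) := fun s =>
      Finset.measurable_fun_sum _ fun j _ => hx.measurable _
    exact (((this _).comp measurable_fst).sub hB).aestronglyMeasurable

theorem summable_succ_rpow_neg {a : ℝ} (ha : 1 < a) :
    Summable fun ℓ : ℕ => ((ℓ : ℝ) + 1) ^ (-a) := by
  have := (summable_nat_add_iff 1).2 (Real.summable_nat_rpow (p := -a).2 (by linarith))
  simpa using this

theorem measurable_comp_pi {Ω' S : Type*} (m : MeasurableSpace Ω') [MeasurableSpace S]
    {g : (ℕ → S) → ℝ} (hg : Measurable g) {z : Ω' → ℕ → S}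
    (hz : ∀ k, Measurable[m] fun ω => z ω k) : Measurable[m] fun ω => g (z ω) :=
  hg.comp (measurable_pi_iff.2 hz)

/-- Decomposability with a summable rate of decay decouples adjacent blocks: replacing all
innovations before the second block by their independent copy changes its sum by at most
`∑ c ℓ^{-a}`. -/
theorem IsDecomposableShift.hasDecoupledBlocks [IsProbabilityMeasure P] {S : Type*}
    [MeasurableSpace S] {η : ℤ → Ω → S} {x : ℤ → Ω → ℝ} {p a c : ℝ} (hp : 1 ≤ p) (ha : 1 < a)
    (hx : IsDecomposableShift P η x p a c) :
    HasDecoupledBlocks P x p (c * ∑' ℓ : ℕ, ((ℓ : ℝ) + 1) ^ (-a)) := by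
  obtain ⟨g, hg, hxg, hdec⟩ := hx.exists_shift
  have hη := hx.iid
  have hxm : ∀ t, Measurable (x t) := fun t => by
    rw [show x t = fun ω => g (innovationPast η t ω) from funext (hxg t)]
    exact hg.comp (hη.measurable_innovationPast t)
  refine ⟨hxm, fun s n => ⟨fun q => ∑ j ∈ Finset.range n,
    g (coupledPast η (s + n + (j : ℤ)) (j + 1) q), ?_, ?_, ?_⟩⟩
  · exact Finset.measurable_fun_sum _ fun j _ => hg.comp (hη.measurable_coupledPast _ _)
  · refine hη.indepFun_fst_of_measurable (s + n) (A := blockSum x s n) ?_ ?_ ?_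
    · refine Finset.measurable_fun_sum _ fun j hj => ?_
      rw [show x (s + j) = fun ω => g (innovationPast η (s + j) ω) from funext (hxg _)]
      refine measurable_comp_pi _ hg fun k => ?_
      have hmem : s + (j : ℤ) - (k : ℤ) ∈ Set.Iio (s + (n : ℤ)) := by
        have := Finset.mem_range.1 hj
        rw [Set.mem_Iio]; omega
      exact measurable_iff_comap_le.2
        (le_iSup₂_of_le (s + (j : ℤ) - (k : ℤ)) hmem le_rfl)
    · exact Finset.measurable_fun_sum _ fun j _ => hg.comp (hη.measurable_coupledPast _ _)
    · intro ω'
      refine Finset.measurable_fun_sum _ fun j hj => ?_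
      refine measurable_comp_pi _ hg fun k => ?_
      unfold coupledPast
      split_ifs with hk
      · have hmem : s + (n : ℤ) + (j : ℤ) - (k : ℤ) ∈ Set.Ici (s + (n : ℤ)) := by
          rw [Set.mem_Ici]; omega
        exact measurable_iff_comap_le.2
          (le_iSup₂_of_le (s + (n : ℤ) + (j : ℤ) - (k : ℤ)) hmem le_rfl)
      · dsimp only
        exact @measurable_const _ _ _ _ _
  · have heq : (fun q : Ω × Ω => blockSum x (s + n) n q.1 -
        ∑ j ∈ Finset.range n, g (coupledPast η (s + n + (j : ℤ)) (j + 1) q)) =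
        ∑ j ∈ Finset.range n, fun q : Ω × Ω => g (innovationPast η (s + n + (j : ℤ)) q.1) -
          g (coupledPast η (s + n + (j : ℤ)) (j + 1) q) := by
      funext q
      simp only [blockSum, Finset.sum_apply, Finset.sum_sub_distrib, hxg]
    rw [heq]
    refine (eLpNorm_sum_le (fun j _ => ?_) (by simpa using hp)).trans ?_
    · exact ((hg.comp ((hη.measurable_innovationPast _).comp measurable_fst)).sub
        (hg.comp (hη.measurable_coupledPast _ _))).aestronglyMeasurable
    · refine (Finset.sum_le_sum fun (j : ℕ) _ =>
        hdec (s + n + (j : ℤ)) (j + 1) (Nat.le_add_left 1 j)).trans ?_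
      rw [← ENNReal.ofReal_sum_of_nonneg]
      · refine ENNReal.ofReal_le_ofReal ?_
        rw [← Finset.mul_sum]
        refine mul_le_mul_of_nonneg_left ?_ hx.c_pos.le
        refine le_trans (le_of_eq ?_)
          ((summable_succ_rpow_neg ha).sum_le_tsum (Finset.range n) fun j _ => by positivity)
        push_cast
        rfl
      · intro j _
        have := hx.c_pos
        positivity

theorem measurable_blockSum {x : ℤ → Ω → ℝ} (hx : ∀ t, Measurable (x t)) (s : ℤ) (n : ℕ) :
    Measurable (blockSum x s n) :=
  Finset.measurable_fun_sum _ fun _ _ => hx _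

theorem integral_blockSum_eq_zero {x : ℤ → Ω → ℝ} (hx : ∀ t, Integrable (x t) P)
    (h0 : ∀ t, ∫ ω, x t ω ∂P = 0) (s : ℤ) (n : ℕ) : ∫ ω, blockSum x s n ω ∂P = 0 := by
  simp only [blockSum]
  rw [integral_finsetSum _ fun j _ => hx _]
  simp [h0]

theorem eLpNorm_comp_fst [IsProbabilityMeasure P] {f : Ω → ℝ} (hf : Measurable f) (r : ℝ≥0∞) :
    eLpNorm (fun q : Ω × Ω => f q.1) r (P.prod P) = eLpNorm f r P :=
  eLpNorm_comp_measurePreserving hf.aestronglyMeasurable measurePreserving_fst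

theorem eLpNorm_abs (f : Ω → ℝ) (r : ℝ≥0∞) : eLpNorm (fun ω => |f ω|) r P = eLpNorm f r P :=
  eLpNorm_norm f

theorem sqrt_two_pow_succ (k : ℕ) : √2 ^ (k + 1) = √2 * √2 ^ k := pow_succ' _ _

/-- Bound in `L²` by doubling: the two halves of a block are orthogonal up to the decoupling error.
The negative term in the bound absorbs the errors of all doubling steps, as
`8 (√2 - 1) > 3` and each step costs at most `3 c`. -/
theorem HasDecoupledBlocks.eLpNorm_two_le [IsProbabilityMeasure P] {x : ℤ → Ω → ℝ} {c b : ℝ}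
    (hx : HasDecoupledBlocks P x 2 c) (hc : 0 ≤ c) (hb : 0 ≤ b)
    (hxb : ∀ t, eLpNorm (x t) 2 P ≤ ENNReal.ofReal b) (h0 : ∀ t, ∫ ω, x t ω ∂P = 0)
    (k : ℕ) : ∀ s, eLpNorm (blockSum x s (2 ^ k)) 2 P ≤
      ENNReal.ofReal ((b + 8 * c) * √2 ^ k - 8 * c) := by
  have h2 : (1.4 : ℝ) ≤ √2 := Real.le_sqrt_of_sq_le (by norm_num)
  have h2' : √2 ≤ (1.5 : ℝ) := Real.sqrt_le_iff.2 (by norm_num)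
  have hsq : √2 ^ 2 = (2 : ℝ) := Real.sq_sqrt (by norm_num)
  have hint : ∀ t, Integrable (x t) P := fun t =>
    (MemLp.integrable (q := 2) (by norm_num)
      ⟨(hx.measurable t).aestronglyMeasurable, (hxb t).trans_lt ENNReal.ofReal_lt_top⟩)
  induction k with
  | zero =>
    intro s
    have : blockSum x s (2 ^ 0) = x s := by funext ω; simp [blockSum]
    rw [this]
    simpa using hxb s
  | succ k ih =>
    intro s
    set m : ℝ := (b + 8 * c) * √2 ^ k - 8 * c with hm
    have hpow : 1 ≤ √2 ^ k := one_le_pow₀ (by linarith)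
    have hm0 : 0 ≤ m := by nlinarith
    obtain ⟨B, hB, hind, hle⟩ := hx.exists_indepFun s (2 ^ k)
    have hA := measurable_blockSum hx.measurable s (2 ^ k)
    have hA' := measurable_blockSum hx.measurable (s + (2 ^ k : ℕ)) (2 ^ k)
    have hD : Measurable fun q : Ω × Ω => blockSum x (s + (2 ^ k : ℕ)) (2 ^ k) q.1 - B q :=
      (hA'.comp measurable_fst).sub hB
    rw [show ENNReal.ofReal 2 = 2 by simp] at hle
    have hBm : eLpNorm B 2 (P.prod P) ≤ ENNReal.ofReal (m + c) := by
      have : B = (fun q : Ω × Ω => blockSum x (s + (2 ^ k : ℕ)) (2 ^ k) q.1) -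
          fun q => blockSum x (s + (2 ^ k : ℕ)) (2 ^ k) q.1 - B q := by
        funext q; simp
      rw [this, ENNReal.ofReal_add hm0 hc]
      refine (eLpNorm_sub_le (hA'.comp measurable_fst).aestronglyMeasurable
        hD.aestronglyMeasurable (by norm_num)).trans (add_le_add ?_ hle)
      exact (eLpNorm_comp_fst hA' _).trans_le (ih _)
    have hAm : eLpNorm (fun q : Ω × Ω => blockSum x s (2 ^ k) q.1) 2 (P.prod P) ≤
        ENNReal.ofReal m := by
      rw [eLpNorm_comp_fst hA]; exact ih s
    have hA0 : ∫ q : Ω × Ω, blockSum x s (2 ^ k) q.1 ∂(P.prod P) = 0 := by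
      rw [integral_fun_fst]
      simp [integral_blockSum_eq_zero hint h0]
    have hsum := eLpNorm_two_add_le_of_indepFun (hA.comp measurable_fst) hB hind hA0 hm0
      (by positivity) hAm hBm
    rw [← eLpNorm_comp_fst (measurable_blockSum hx.measurable s (2 ^ (k + 1)))]
    have hdecomp : (fun q : Ω × Ω => blockSum x s (2 ^ (k + 1)) q.1) =
        ((blockSum x s (2 ^ k) ∘ Prod.fst) + B) +
          fun q => blockSum x (s + (2 ^ k : ℕ)) (2 ^ k) q.1 - B q := by
      funext q
      rw [pow_succ, mul_two, blockSum_add]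
      simp
    rw [hdecomp]
    refine (eLpNorm_add_le ((hA.comp measurable_fst).add hB).aestronglyMeasurable
      hD.aestronglyMeasurable (by norm_num)).trans ((add_le_add hsum hle).trans ?_)
    rw [← ENNReal.ofReal_add (Real.sqrt_nonneg _) hc]
    refine ENNReal.ofReal_le_ofReal ?_
    have hroot : √(m ^ 2 + (m + c) ^ 2) ≤ √2 * (m + c) := by
      refine Real.sqrt_le_iff.2 ⟨by positivity, ?_⟩
      rw [mul_pow, hsq]
      nlinarith
    rw [sqrt_two_pow_succ]
    have : √2 * (m + c) = √2 * ((b + 8 * c) * √2 ^ k) - √2 * (7 * c) := by rw [hm]; ring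
    nlinarith

/-- Bound in `L^p`, `p > 2`, by doubling, given a bound of the right order for moments of order
`p / 2`. -/
theorem HasDecoupledBlocks.exists_eLpNorm_le_of_half [IsProbabilityMeasure P] {p c b d : ℝ}
    (hp : 2 < p) (hc : 0 ≤ c) (hb : 0 ≤ b) (hd : 0 ≤ d) :
    ∃ D, 0 ≤ D ∧ ∀ x : ℤ → Ω → ℝ, HasDecoupledBlocks P x p c →
      (∀ t, eLpNorm (x t) (ENNReal.ofReal p) P ≤ ENNReal.ofReal b) →
      (∀ s k, eLpNorm (blockSum x s (2 ^ k)) (ENNReal.ofReal (p / 2)) P ≤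
        ENNReal.ofReal (d * √2 ^ k)) →
      ∀ k s, eLpNorm (blockSum x s (2 ^ k)) (ENNReal.ofReal p) P ≤
        ENNReal.ofReal (D * √2 ^ k) := by
  have hlt : (2 : ℝ) ^ (1 / p) < √2 := by
    rw [Real.sqrt_eq_rpow]
    exact Real.rpow_lt_rpow_of_exponent_lt (by norm_num)
      (one_div_lt_one_div_of_lt (by norm_num) hp)
  have h2p : 0 < (2 : ℝ) ^ (1 / p) := by positivity
  -- the growth factor `r` lies strictly between `2 ^ (1 / p)` and `√2`
  obtain ⟨r, hr1, hr2⟩ := exists_between hlt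
  obtain ⟨κ, hκ⟩ : ∃ κ : ℝ≥0, (κ : ℝ) = r / 2 ^ (1 / p) - 1 :=
    ⟨⟨r / 2 ^ (1 / p) - 1, by rw [sub_nonneg, le_div_iff₀ h2p]; linarith⟩, rfl⟩
  have hκ0 : 0 < κ := by
    rw [← NNReal.coe_pos, hκ, sub_pos, lt_div_iff₀ h2p]; linarith
  have hκr : (1 + (κ : ℝ)) * 2 ^ (1 / p) = r := by
    rw [hκ]; field_simp; ring
  have hr0 : 0 < r := h2p.trans hr1
  set Q : ℝ := r * c + (1 + (κ : ℝ)⁻¹) * (d + c) + c with hQ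
  have hQ0 : 0 ≤ Q := by positivity
  have hgap : 0 < √2 - r := sub_pos.2 hr2
  have hp1 : (1 : ℝ≥0∞) ≤ ENNReal.ofReal p := by
    rw [ENNReal.one_le_ofReal]; linarith
  have hp2 : (1 : ℝ≥0∞) ≤ ENNReal.ofReal (p / 2) := by
    rw [ENNReal.one_le_ofReal]; linarith
  refine ⟨b + Q / (√2 - r), by positivity, fun x hx hxb hhalf k => ?_⟩
  set D : ℝ := b + Q / (√2 - r) with hD
  have hD0 : 0 ≤ D := by positivity
  have hDrec : r * D + Q ≤ √2 * D := by
    have h1 : Q = (√2 - r) * (Q / (√2 - r)) := by field_simp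
    have h2 : (√2 - r) * (Q / (√2 - r)) ≤ (√2 - r) * D :=
      mul_le_mul_of_nonneg_left (by linarith) hgap.le
    linarith
  induction k with
  | zero =>
    intro s
    have : blockSum x s (2 ^ 0) = x s := by funext ω; simp [blockSum]
    rw [this]
    refine (hxb s).trans (ENNReal.ofReal_le_ofReal ?_)
    have : 0 ≤ Q / (√2 - r) := by positivity
    simp only [pow_zero, mul_one]
    linarith
  | succ k ih =>
    intro s
    have hpow : 1 ≤ √2 ^ k := one_le_pow₀ (Real.one_le_sqrt.2 (by norm_num))
    obtain ⟨B, hB, hind, hle⟩ := hx.exists_indepFun s (2 ^ k)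
    have hA := measurable_blockSum hx.measurable s (2 ^ k)
    have hA' := measurable_blockSum hx.measurable (s + (2 ^ k : ℕ)) (2 ^ k)
    have hDm : Measurable fun q : Ω × Ω => blockSum x (s + (2 ^ k : ℕ)) (2 ^ k) q.1 - B q :=
      (hA'.comp measurable_fst).sub hB
    have hBr : ∀ {r' z : ℝ}, (1 : ℝ≥0∞) ≤ ENNReal.ofReal r' → r' ≤ p → 0 ≤ z →
        eLpNorm (blockSum x (s + (2 ^ k : ℕ)) (2 ^ k)) (ENNReal.ofReal r') P ≤
          ENNReal.ofReal z →
        eLpNorm B (ENNReal.ofReal r') (P.prod P) ≤ ENNReal.ofReal (z + c) := by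
      intro r' z hr1 hrp hz hbd
      have : B = (fun q : Ω × Ω => blockSum x (s + (2 ^ k : ℕ)) (2 ^ k) q.1) -
          fun q => blockSum x (s + (2 ^ k : ℕ)) (2 ^ k) q.1 - B q := by
        funext q; simp
      rw [this, ENNReal.ofReal_add hz hc]
      refine (eLpNorm_sub_le (hA'.comp measurable_fst).aestronglyMeasurable
        hDm.aestronglyMeasurable hr1).trans (add_le_add ?_ ?_)
      · exact (eLpNorm_comp_fst hA' _).trans_le hbd
      · exact (eLpNorm_le_eLpNorm_of_exponent_le (ENNReal.ofReal_le_ofReal hrp)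
          hDm.aestronglyMeasurable).trans hle
    have hAr : ∀ {r' z : ℝ},
        eLpNorm (blockSum x s (2 ^ k)) (ENNReal.ofReal r') P ≤ ENNReal.ofReal z →
        eLpNorm (fun q : Ω × Ω => blockSum x s (2 ^ k) q.1) (ENNReal.ofReal r') (P.prod P) ≤
          ENNReal.ofReal (z + c) := by
      intro r' z hbd
      rw [eLpNorm_comp_fst hA]
      exact hbd.trans (ENNReal.ofReal_le_ofReal (by linarith))
    have hsum := eLpNorm_add_le_of_indepFun hp.le hκ0 (hA.comp measurable_fst) hB hind
      (m := D * √2 ^ k + c) (d := d * √2 ^ k + c) (by positivity) (by positivity)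
      (hAr (ih s)) (hBr hp1 le_rfl (by positivity) (ih _)) (hAr (hhalf s k))
      (hBr hp2 (by linarith) (by positivity) (hhalf _ k))
    rw [← eLpNorm_comp_fst (measurable_blockSum hx.measurable s (2 ^ (k + 1)))]
    have hdecomp : (fun q : Ω × Ω => blockSum x s (2 ^ (k + 1)) q.1) =
        ((blockSum x s (2 ^ k) ∘ Prod.fst) + B) +
          fun q => blockSum x (s + (2 ^ k : ℕ)) (2 ^ k) q.1 - B q := by
      funext q
      rw [pow_succ, mul_two, blockSum_add]
      simp
    rw [hdecomp]
    refine (eLpNorm_add_le ((hA.comp measurable_fst).add hB).aestronglyMeasurable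
      hDm.aestronglyMeasurable hp1).trans ((add_le_add hsum hle).trans ?_)
    rw [← ENNReal.ofReal_add (by positivity) hc, hκr]
    refine ENNReal.ofReal_le_ofReal ?_
    rw [sqrt_two_pow_succ]
    have hQle : r * c + (1 + (κ : ℝ)⁻¹) * (d * √2 ^ k + c) + c ≤ Q * √2 ^ k := by
      have e1 : r * c ≤ r * c * √2 ^ k := le_mul_of_one_le_right (by positivity) hpow
      have e2 : (1 + (κ : ℝ)⁻¹) * c ≤ (1 + (κ : ℝ)⁻¹) * c * √2 ^ k :=
        le_mul_of_one_le_right (by positivity) hpow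
      have e3 : c ≤ c * √2 ^ k := le_mul_of_one_le_right hc hpow
      rw [hQ]
      linarith
    calc r * (D * √2 ^ k + c) + (1 + (κ : ℝ)⁻¹) * (d * √2 ^ k + c) + c
        ≤ r * D * √2 ^ k + Q * √2 ^ k := by linarith
      _ = (r * D + Q) * √2 ^ k := by ring
      _ ≤ (√2 * D) * √2 ^ k := by gcongr
      _ = D * (√2 * √2 ^ k) := by ring

/-- Sums over dyadic blocks of a centred process with decoupled blocks have the order of magnitude
of independent sums in `L^p`, uniformly over processes with common constants. -/
theorem HasDecoupledBlocks.exists_eLpNorm_le (P : Measure Ω) [IsProbabilityMeasure P] {p c b : ℝ}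
    (hp : 2 ≤ p) (hc : 0 ≤ c) (hb : 0 ≤ b) :
    ∃ D, 0 ≤ D ∧ ∀ x : ℤ → Ω → ℝ, HasDecoupledBlocks P x p c →
      (∀ t, eLpNorm (x t) (ENNReal.ofReal p) P ≤ ENNReal.ofReal b) →
      (∀ t, ∫ ω, x t ω ∂P = 0) →
      ∀ k s, eLpNorm (blockSum x s (2 ^ k)) (ENNReal.ofReal p) P ≤
        ENNReal.ofReal (D * √2 ^ k) := by
  have h2 : ∀ x : ℤ → Ω → ℝ, HasDecoupledBlocks P x 2 c →
      (∀ t, eLpNorm (x t) (ENNReal.ofReal 2) P ≤ ENNReal.ofReal b) →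
      (∀ t, ∫ ω, x t ω ∂P = 0) →
      ∀ k s, eLpNorm (blockSum x s (2 ^ k)) (ENNReal.ofReal 2) P ≤
        ENNReal.ofReal ((b + 8 * c) * √2 ^ k) := by
    intro x hx hxb h0 k s
    rw [show ENNReal.ofReal 2 = 2 by simp] at hxb ⊢
    exact (hx.eLpNorm_two_le hc hb hxb h0 k s).trans
      (ENNReal.ofReal_le_ofReal (by linarith))
  -- induction on the number of times `p` has to be halved to fall below `2`
  obtain ⟨n, hn⟩ : ∃ n : ℕ, p ≤ 2 ^ n := pow_unbounded_of_one_lt p (by norm_num) |>.imp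
    fun _ h => h.le
  induction n generalizing p with
  | zero => norm_num at hn; linarith
  | succ n ih =>
    rcases hp.eq_or_lt with rfl | hp'
    · exact ⟨_, by positivity, h2⟩
    obtain ⟨d, hd, hhalf⟩ : ∃ d, 0 ≤ d ∧ ∀ x : ℤ → Ω → ℝ, HasDecoupledBlocks P x p c →
        (∀ t, eLpNorm (x t) (ENNReal.ofReal p) P ≤ ENNReal.ofReal b) →
        (∀ t, ∫ ω, x t ω ∂P = 0) →
        ∀ s k, eLpNorm (blockSum x s (2 ^ k)) (ENNReal.ofReal (p / 2)) P ≤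
          ENNReal.ofReal (d * √2 ^ k) := by
      obtain ⟨q, hq2, hqp, hqq, d, hd, h⟩ : ∃ q, 2 ≤ q ∧ q ≤ p ∧ p / 2 ≤ q ∧ ∃ d, 0 ≤ d ∧
          ∀ x : ℤ → Ω → ℝ, HasDecoupledBlocks P x q c →
          (∀ t, eLpNorm (x t) (ENNReal.ofReal q) P ≤ ENNReal.ofReal b) →
          (∀ t, ∫ ω, x t ω ∂P = 0) →
          ∀ k s, eLpNorm (blockSum x s (2 ^ k)) (ENNReal.ofReal q) P ≤
            ENNReal.ofReal (d * √2 ^ k) := by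
        rcases le_total 2 (p / 2) with h | h
        · exact ⟨p / 2, h, by linarith, le_rfl, ih h (by rw [pow_succ] at hn; linarith)⟩
        · exact ⟨2, le_rfl, hp, h, _, by positivity, h2⟩
      refine ⟨d, hd, fun x hx hxb h0 s k => ?_⟩
      refine (eLpNorm_le_eLpNorm_of_exponent_le (ENNReal.ofReal_le_ofReal hqq)
        (measurable_blockSum hx.measurable _ _).aestronglyMeasurable).trans ?_
      refine h x (hx.mono_exponent hqp) (fun t => le_trans ?_ (hxb t)) h0 k s
      exact eLpNorm_le_eLpNorm_of_exponent_le (ENNReal.ofReal_le_ofReal hqp)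
        (hx.measurable t).aestronglyMeasurable
    obtain ⟨D, hD, h⟩ := HasDecoupledBlocks.exists_eLpNorm_le_of_half (P := P) hp' hc hb hd
    exact ⟨D, hD, fun x hx hxb h0 => h x hx hxb (hhalf x hx hxb h0)⟩

/-- Maximal inequality: since `2 ^ (1 / p) < √2`, splitting dyadically shows that the running
maximum of the partial sums has the same order as the sums themselves. -/
theorem exists_maximal_le {p D : ℝ} (hp : 2 < p) (hD : 0 ≤ D) :
    ∃ D', 0 ≤ D' ∧ ∀ x : ℤ → Ω → ℝ, (∀ t, Measurable (x t)) →
      (∀ k s, eLpNorm (blockSum x s (2 ^ k)) (ENNReal.ofReal p) P ≤ ENNReal.ofReal (D * √2 ^ k)) →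
      ∀ k s, ∃ F : Ω → ℝ, Measurable F ∧ (∀ n ≤ 2 ^ k, ∀ ω, |blockSum x s n ω| ≤ F ω) ∧
        eLpNorm F (ENNReal.ofReal p) P ≤ ENNReal.ofReal (D' * √2 ^ k) := by
  have hlt : (2 : ℝ) ^ (1 / p) < √2 := by
    rw [Real.sqrt_eq_rpow]
    exact Real.rpow_lt_rpow_of_exponent_lt (by norm_num)
      (one_div_lt_one_div_of_lt (by norm_num) hp)
  set r : ℝ := (2 : ℝ) ^ (1 / p) with hr
  have hr0 : 0 < r := by positivity
  have hgap : 0 < √2 - r := sub_pos.2 hlt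
  refine ⟨D + D / (√2 - r), by positivity, fun x hxm hx k => ?_⟩
  set D' : ℝ := D + D / (√2 - r) with hD'
  have hDrec : D + r * D' ≤ √2 * D' := by
    have h1 : D = (√2 - r) * (D / (√2 - r)) := by field_simp
    have h2 : (√2 - r) * (D / (√2 - r)) ≤ (√2 - r) * D' :=
      mul_le_mul_of_nonneg_left (by linarith) hgap.le
    linarith
  have hDD : D ≤ D' := by
    have : 0 ≤ D / (√2 - r) := by positivity
    linarith
  induction k with
  | zero =>
    intro s
    refine ⟨fun ω => |x s ω|, (hxm s).abs, fun n hn ω => ?_, ?_⟩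
    · have : n = 0 ∨ n = 1 := by simp at hn; omega
      rcases this with rfl | rfl <;> simp [blockSum]
    · have h1 : blockSum x s (2 ^ 0) = x s := by funext ω; simp [blockSum]
      have h2 := hx 0 s
      rw [h1] at h2
      have h3 : eLpNorm (fun ω => |x s ω|) (ENNReal.ofReal p) P =
          eLpNorm (x s) (ENNReal.ofReal p) P := eLpNorm_abs _ _
      rw [h3]
      refine h2.trans (ENNReal.ofReal_le_ofReal ?_)
      simpa using hDD
  | succ k ih =>
    intro s
    obtain ⟨F, hF, hFle, hFn⟩ := ih s
    obtain ⟨G, hG, hGle, hGn⟩ := ih (s + (2 ^ k : ℕ))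
    have hA := measurable_blockSum hxm s (2 ^ k)
    refine ⟨(fun ω => |blockSum x s (2 ^ k) ω|) + fun ω => max (F ω) (G ω),
      hA.abs.add (hF.max hG), fun n hn ω => ?_, ?_⟩
    · change _ ≤ |blockSum x s (2 ^ k) ω| + max (F ω) (G ω)
      rcases le_total n (2 ^ k) with h | h
      · exact (hFle n h ω).trans ((le_max_left _ _).trans
          (le_add_of_nonneg_left (abs_nonneg _)))
      · obtain ⟨j, rfl⟩ := Nat.exists_eq_add_of_le h
        rw [blockSum_add]
        refine (abs_add_le _ _).trans (add_le_add le_rfl ?_)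
        exact (hGle j (by rw [pow_succ] at hn; omega) ω).trans (le_max_right _ _)
    · refine (eLpNorm_add_le hA.abs.aestronglyMeasurable
        (hF.max hG).aestronglyMeasurable (by rw [ENNReal.one_le_ofReal]; linarith)).trans ?_
      have h3 : eLpNorm (fun ω => |blockSum x s (2 ^ k) ω|) (ENNReal.ofReal p) P =
          eLpNorm (blockSum x s (2 ^ k)) (ENNReal.ofReal p) P := eLpNorm_abs _ _
      rw [h3]
      refine (add_le_add (hx k s) (eLpNorm_max_le hp.le hF hFn hGn)).trans ?_
      rw [← ENNReal.ofReal_add (by positivity) (by positivity)]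
      refine ENNReal.ofReal_le_ofReal ?_
      calc D * √2 ^ k + r * (D' * √2 ^ k) = (D + r * D') * √2 ^ k := by ring
        _ ≤ (√2 * D') * √2 ^ k := by gcongr
        _ = D' * √2 ^ (k + 1) := by rw [sqrt_two_pow_succ]; ring

end Blocks

/-! ### Almost sure rates for time averages -/

section Rates

theorem sum_Icc_one_eq_sum_range (T : ℕ) (z : ℤ → ℝ) :
    ∑ t ∈ Finset.Icc (1 : ℤ) T, z t = ∑ j ∈ Finset.range T, z (1 + (j : ℤ)) := by
  symm
  refine Finset.sum_bij (fun j _ => 1 + (j : ℤ)) ?_ ?_ ?_ ?_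
  · intro j hj
    have := Finset.mem_range.1 hj
    rw [Finset.mem_Icc]; omega
  · intro a _ b _ h
    omega
  · intro t ht
    rw [Finset.mem_Icc] at ht
    exact ⟨(t - 1).toNat, Finset.mem_range.2 (by omega), by omega⟩
  · intro j _
    rfl

theorem rpow_le_two_rpow_abs {z : ℝ} (h1 : 1 ≤ z) (h2 : z ≤ 2) (s : ℝ) : z ^ s ≤ 2 ^ |s| :=
  (Real.rpow_le_rpow_of_exponent_le h1 (le_abs_self s)).trans
    (Real.rpow_le_rpow (by linarith) h2 (abs_nonneg s))

/-- Every `T ≥ 1` is within a factor `2` below a power of `2`. -/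
theorem exists_two_pow_mul_eq {T : ℕ} (hT : 1 ≤ T) :
    ∃ (k : ℕ) (z : ℝ), T ≤ 2 ^ k ∧ (2 : ℝ) ^ k = z * T ∧ 1 ≤ z ∧ z ≤ 2 := by
  have hT0 : (0 : ℝ) < T := by exact_mod_cast hT
  refine ⟨Nat.clog 2 T, 2 ^ Nat.clog 2 T / T, Nat.le_pow_clog (by norm_num) T, ?_, ?_, ?_⟩
  · field_simp
  · rw [one_le_div hT0]
    exact_mod_cast Nat.le_pow_clog (by norm_num) T
  · rw [div_le_iff₀ hT0]
    rcases hT.eq_or_lt with rfl | h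
    · simp
    · have h1 := Nat.pow_pred_clog_lt_self (b := 2) (by norm_num) h
      have h2 : 0 < Nat.clog 2 T := Nat.clog_pos (by norm_num) h
      obtain ⟨m, hm⟩ : ∃ m, Nat.clog 2 T = m + 1 := ⟨_, (Nat.succ_pred_eq_of_pos h2).symm⟩
      rw [hm] at h1 ⊢
      rw [pow_succ, mul_comm]
      have : 2 ^ m ≤ T := h1.le
      have : (2 : ℝ) ^ m ≤ T := by exact_mod_cast this
      linarith

theorem timeMean_eq_blockSum {Ω : Type*} (T : ℕ) (x : ℤ → Ω → ℝ) (ω : Ω) :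
    timeMean T (fun t => x t ω) = (T : ℝ)⁻¹ * blockSum x 1 T ω := by
  rw [timeMean, sum_Icc_one_eq_sum_range, blockSum]

variable {Ω : Type*} [MeasurableSpace Ω] {P : Measure Ω}

/-- Almost sure rate for the time averages of the first `C T ^ θ` of a family of centred processes
with common constants. Over dyadic ranges of `T` the maximal inequality and a union bound over
the units leave the convergent series `∑ 2 ^ (k (θ + p δ - p / 2))`. -/
theorem ae_exists_abs_timeMean_le [IsProbabilityMeasure P] {p c b : ℝ} (hp : 2 < p) (hc : 0 ≤ c)
    (hb : 0 ≤ b) {x : ℕ → ℤ → Ω → ℝ} (hx : ∀ i, HasDecoupledBlocks P (x i) p c)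
    (hxb : ∀ i t, eLpNorm (x i t) (ENNReal.ofReal p) P ≤ ENNReal.ofReal b)
    (h0 : ∀ i t, ∫ ω, x i t ω ∂P = 0) (C : ℝ) {θ δ : ℝ} (hθ : θ + p * δ < p / 2) :
    ∀ᵐ ω ∂P, ∃ R, 0 ≤ R ∧ ∀ T : ℕ, 1 ≤ T → ∀ i : ℕ, (i : ℝ) + 1 ≤ C * (T : ℝ) ^ θ →
      |timeMean T (fun t => x i t ω)| ≤ R * (T : ℝ) ^ (-δ) := by
  have hp0 : 0 < p := by linarith
  obtain ⟨D, hD, hblock⟩ := HasDecoupledBlocks.exists_eLpNorm_le P hp.le hc hb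
  obtain ⟨D', hD', hmax⟩ := exists_maximal_le (P := P) hp hD
  choose F hFm hFle hFn using fun i k =>
    hmax (x i) (hx i).measurable (hblock (x i) (hx i) (hxb i) (h0 i)) k 1
  set C' : ℝ := |C| * 2 ^ |θ| with hC'
  set n : ℕ → ℕ := fun k => ⌊C' * (2 ^ k : ℝ) ^ θ⌋₊ with hn
  set w : ℕ → ℝ := fun k => (2 ^ k : ℝ) ^ (-(p * (1 - δ))) with hw
  set ρ : ℝ := 2 ^ (θ + p * δ - p / 2) with hρ
  have hρ1 : ρ < 1 := Real.rpow_lt_one_of_one_lt_of_neg (by norm_num) (by linarith)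
  have hρ0 : 0 < ρ := by positivity
  -- `F i k` dominates the partial sums up to time `2 ^ k`, and `w k` is the weight that makes the
  -- `p`-th power of the bound `(2 ^ k) ^ (1 - δ)` equal to one
  set G : ℕ → Ω → ℝ≥0∞ := fun k ω =>
    ∑ i ∈ Finset.range (n k), ‖F i k ω‖ₑ ^ p * ENNReal.ofReal (w k) with hG
  have hFe : ∀ i k, Measurable fun ω => ‖F i k ω‖ₑ ^ p * ENNReal.ofReal (w k) := fun i k =>
    ((hFm i k).enorm.pow_const p).mul_const _
  have hGm : ∀ k, Measurable (G k) := fun k => Finset.measurable_fun_sum _ fun i _ => hFe i k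
  have hGint : ∀ k, ∫⁻ ω, G k ω ∂P ≤ ENNReal.ofReal (C' * D' ^ p * ρ ^ k) := by
    intro k
    simp only [hG]
    rw [lintegral_finsetSum _ fun i _ => hFe i k]
    have h1 : ∀ i ∈ Finset.range (n k), ∫⁻ ω, ‖F i k ω‖ₑ ^ p * ENNReal.ofReal (w k) ∂P ≤
        ENNReal.ofReal ((D' * √2 ^ k) ^ p * w k) := by
      intro i _
      rw [lintegral_mul_const _ ((hFm i k).enorm.pow_const p), ← eLpNorm_ofReal_rpow hp0,
        ENNReal.ofReal_mul (by positivity), ← ENNReal.ofReal_rpow_of_nonneg (by positivity) hp0.le]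
      gcongr
      exact hFn i k
    refine (Finset.sum_le_sum h1).trans ?_
    rw [Finset.sum_const, Finset.card_range, nsmul_eq_mul, ← ENNReal.ofReal_natCast,
      ← ENNReal.ofReal_mul (by positivity)]
    refine ENNReal.ofReal_le_ofReal ?_
    have h2 : (n k : ℝ) ≤ C' * (2 ^ k : ℝ) ^ θ := Nat.floor_le (by positivity)
    have h3 : (D' * √2 ^ k) ^ p = D' ^ p * (2 ^ k : ℝ) ^ (p / 2) := by
      rw [Real.mul_rpow hD' (by positivity)]
      congr 1
      have : √2 ^ k = (2 ^ k : ℝ) ^ (1 / 2 : ℝ) := by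
        rw [← Real.sqrt_eq_rpow, Real.sqrt_eq_rpow, Real.sqrt_eq_rpow, ← Real.rpow_natCast,
          ← Real.rpow_natCast, ← Real.rpow_mul (by norm_num), ← Real.rpow_mul (by norm_num),
          mul_comm]
      rw [this, ← Real.rpow_mul (by positivity)]
      congr 1; ring
    have h4 : ρ ^ k = (2 ^ k : ℝ) ^ θ * (2 ^ k : ℝ) ^ (p / 2) * w k := by
      rw [hw, ← Real.rpow_add (by positivity), ← Real.rpow_add (by positivity), hρ,
        ← Real.rpow_natCast, ← Real.rpow_natCast, ← Real.rpow_mul (by norm_num),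
        ← Real.rpow_mul (by norm_num)]
      congr 1; ring
    rw [h3, h4]
    calc (n k : ℝ) * (D' ^ p * (2 ^ k : ℝ) ^ (p / 2) * w k)
        ≤ (C' * (2 ^ k : ℝ) ^ θ) * (D' ^ p * (2 ^ k : ℝ) ^ (p / 2) * w k) := by gcongr
      _ = _ := by ring
  have hfin : ∫⁻ ω, ∑' k, G k ω ∂P ≠ ∞ := by
    rw [lintegral_tsum fun k => (hGm k).aemeasurable]
    refine ne_top_of_le_ne_top ?_ (ENNReal.tsum_le_tsum hGint)
    exact ((summable_geometric_of_lt_one hρ0.le hρ1).mul_left _).tsum_ofReal_ne_top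
  have hae := ae_lt_top (Measurable.tsum hGm) hfin
  filter_upwards [hae] with ω hω
  set R₀ : ℝ := (∑' k, G k ω).toReal with hR₀
  have hR₀0 : 0 ≤ R₀ := ENNReal.toReal_nonneg
  have hFbd : ∀ k, ∀ i < n k, F i k ω ≤ R₀ ^ (1 / p) * (2 ^ k : ℝ) ^ (1 - δ) := by
    intro k i hi
    have hF0 : 0 ≤ F i k ω := (abs_nonneg _).trans (hFle i k 0 (Nat.zero_le _) ω)
    have h1 : ‖F i k ω‖ₑ ^ p * ENNReal.ofReal (w k) ≤ ∑' k, G k ω := by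
      refine le_trans ?_ (ENNReal.le_tsum k)
      exact Finset.single_le_sum (f := fun i => ‖F i k ω‖ₑ ^ p * ENNReal.ofReal (w k))
        (fun _ _ => zero_le) (Finset.mem_range.2 hi)
    rw [Real.enorm_eq_ofReal hF0, ENNReal.ofReal_rpow_of_nonneg hF0 hp0.le,
      ← ENNReal.ofReal_mul (by positivity), ← ENNReal.ofReal_toReal hω.ne,
      ENNReal.ofReal_le_ofReal_iff hR₀0] at h1
    have h2 : F i k ω ^ p ≤ R₀ * (2 ^ k : ℝ) ^ (p * (1 - δ)) := by
      have hw1 : w k * (2 ^ k : ℝ) ^ (p * (1 - δ)) = 1 := by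
        rw [hw, ← Real.rpow_add (by positivity)]; simp
      calc F i k ω ^ p = F i k ω ^ p * w k * (2 ^ k : ℝ) ^ (p * (1 - δ)) := by
            rw [mul_assoc, hw1, mul_one]
        _ ≤ _ := by gcongr
    have h3 := Real.rpow_le_rpow (by positivity) h2 (by positivity : (0 : ℝ) ≤ 1 / p)
    rw [← Real.rpow_mul hF0, mul_one_div_cancel hp0.ne', Real.rpow_one,
      Real.mul_rpow hR₀0 (by positivity), ← Real.rpow_mul (by positivity)] at h3
    have h4 : p * (1 - δ) * (1 / p) = 1 - δ := by field_simp
    rwa [h4] at h3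
  refine ⟨R₀ ^ (1 / p) * 2 ^ |1 - δ|, by positivity, fun T hT i hi => ?_⟩
  have hT0 : (0 : ℝ) < T := by exact_mod_cast hT
  obtain ⟨k, z, hTk, hkz, hz1, hz2⟩ := exists_two_pow_mul_eq hT
  have hz0 : 0 < z := by linarith
  have hin : i < n k := by
    refine Nat.lt_of_succ_le (Nat.le_floor ?_)
    push_cast
    refine hi.trans ?_
    have h1 : (T : ℝ) ^ θ = z ^ (-θ) * (2 ^ k : ℝ) ^ θ := by
      rw [hkz, Real.mul_rpow hz0.le hT0.le, ← mul_assoc, ← Real.rpow_add hz0]; simp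
    have h2 := rpow_le_two_rpow_abs hz1 hz2 (-θ)
    rw [abs_neg] at h2
    calc C * (T : ℝ) ^ θ ≤ |C| * (z ^ (-θ) * (2 ^ k : ℝ) ^ θ) := by
          rw [h1]; gcongr; exact le_abs_self C
      _ ≤ |C| * (2 ^ |θ| * (2 ^ k : ℝ) ^ θ) := by gcongr
      _ = C' * (2 ^ k : ℝ) ^ θ := by rw [hC']; ring
  rw [timeMean_eq_blockSum, abs_mul, abs_inv, abs_of_pos hT0]
  have hb1 := (hFle i k T hTk ω).trans (hFbd k i hin)
  have hb2 : (2 ^ k : ℝ) ^ (1 - δ) ≤ 2 ^ |1 - δ| * (T : ℝ) ^ (1 - δ) := by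
    rw [hkz, Real.mul_rpow hz0.le hT0.le]
    gcongr
    exact rpow_le_two_rpow_abs hz1 hz2 _
  have hTδ : (T : ℝ) ^ (1 - δ) = T * (T : ℝ) ^ (-δ) := by
    rw [sub_eq_add_neg, Real.rpow_add hT0, Real.rpow_one]
  calc (T : ℝ)⁻¹ * |blockSum (x i) 1 T ω|
      ≤ (T : ℝ)⁻¹ * (R₀ ^ (1 / p) * (2 ^ |1 - δ| * (T : ℝ) ^ (1 - δ))) := by
        gcongr
        exact hb1.trans (by gcongr)
    _ = _ := by
        rw [hTδ]; field_simp

end Rates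

/-! ### Transformations of decomposable shifts -/

section Transformations

variable {Ω S : Type*} [MeasurableSpace Ω] [MeasurableSpace S] {P : Measure Ω} {η : ℤ → Ω → S}

theorem IsDecomposableShift.measurable {E : Type*} [NormedAddCommGroup E] [MeasurableSpace E]
    {x : ℤ → Ω → E} {p a c : ℝ} (hx : IsDecomposableShift P η x p a c) (t : ℤ) :
    Measurable (x t) := by
  obtain ⟨g, hg, hxg, -⟩ := hx.exists_shift
  rw [show x t = fun ω => g (innovationPast η t ω) from funext (hxg t)]
  exact hg.comp (hx.iid.measurable_innovationPast t)

theorem IsDecomposableShift.identDistrib {E : Type*} [NormedAddCommGroup E] [MeasurableSpace E]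
    {x : ℤ → Ω → E} {p a c : ℝ} (hx : IsDecomposableShift P η x p a c) (t : ℤ) :
    IdentDistrib (x t) (x 0) P P := by
  obtain ⟨g, hg, hxg, -⟩ := hx.exists_shift
  rw [show x t = g ∘ innovationPast η t from funext (hxg t),
    show x 0 = g ∘ innovationPast η 0 from funext (hxg 0)]
  exact (hx.iid.identDistrib_innovationPast t).comp hg

/-- The innovations may be replaced by a finer i.i.d. sequence. -/
theorem IsDecomposableShift.of_factor {E : Type*} [NormedAddCommGroup E] [MeasurableSpace E]
    {S' : Type*} [MeasurableSpace S'] {ζ : ℤ → Ω → S'} (hζ : IsIIDSeq P ζ) {φ : S' → S}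
    (hφ : Measurable φ) {x : ℤ → Ω → E} {p a c : ℝ}
    (hx : IsDecomposableShift P (fun t ω => φ (ζ t ω)) x p a c) :
    IsDecomposableShift P ζ x p a c where
  a_pos := hx.a_pos
  c_pos := hx.c_pos
  iid := hζ
  memLp := hx.memLp
  exists_shift := by
    obtain ⟨g, hg, hxg, hdec⟩ := hx.exists_shift
    refine ⟨fun z => g fun k => φ (z k), hg.comp ?_, hxg, fun t ℓ hℓ => ?_⟩
    · exact measurable_pi_iff.2 fun k => hφ.comp (measurable_pi_apply k)
    · convert hdec t ℓ hℓ using 2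
      funext q
      congr 1
      change g _ = g _
      congr 1
      funext k
      simp only [coupledPast]
      split_ifs <;> rfl

theorem IsDecomposableShift.coord {K : ℕ} {x : ℤ → Ω → EuclideanSpace ℝ (Fin K)} {p a c : ℝ}
    (hx : IsDecomposableShift P η x p a c) (k : Fin K) :
    IsDecomposableShift P η (fun t ω => x t ω k) p a c where
  a_pos := hx.a_pos
  c_pos := hx.c_pos
  iid := hx.iid
  memLp := fun t => by
    refine (hx.memLp t).mono ?_ (ae_of_all _ fun ω => PiLp.norm_apply_le (x t ω) k)
    exact ((measurable_pi_apply k).comp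
      ((WithLp.measurable_ofLp 2 _).comp (hx.measurable t))).aestronglyMeasurable
  exists_shift := by
    obtain ⟨g, hg, hxg, hdec⟩ := hx.exists_shift
    refine ⟨fun z => g z k, (measurable_pi_apply k).comp ((WithLp.measurable_ofLp 2 _).comp hg),
      fun t ω => by rw [hxg], fun t ℓ hℓ => le_trans ?_ (hdec t ℓ hℓ)⟩
    refine eLpNorm_mono fun q => ?_
    exact PiLp.norm_apply_le
      (g (innovationPast η t q.1) - g (coupledPast η t ℓ q)) k

theorem IsDecomposableShift.sub_const [IsFiniteMeasure P] {x : ℤ → Ω → ℝ} {p a c : ℝ}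
    (hx : IsDecomposableShift P η x p a c) (m : ℝ) :
    IsDecomposableShift P η (fun t ω => x t ω - m) p a c where
  a_pos := hx.a_pos
  c_pos := hx.c_pos
  iid := hx.iid
  memLp := fun t => (hx.memLp t).sub (memLp_const m)
  exists_shift := by
    obtain ⟨g, hg, hxg, hdec⟩ := hx.exists_shift
    refine ⟨fun z => g z - m, hg.sub_const m, fun t ω => by rw [hxg], fun t ℓ hℓ => ?_⟩
    simpa using hdec t ℓ hℓ

theorem IsDecomposableShift.mono_exponent [IsProbabilityMeasure P] {x : ℤ → Ω → ℝ} {p q a c : ℝ}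
    (hx : IsDecomposableShift P η x p a c) (hqp : q ≤ p) :
    IsDecomposableShift P η x q a c where
  a_pos := hx.a_pos
  c_pos := hx.c_pos
  iid := hx.iid
  memLp := fun t => (hx.memLp t).mono_exponent (ENNReal.ofReal_le_ofReal hqp)
  exists_shift := by
    obtain ⟨g, hg, hxg, hdec⟩ := hx.exists_shift
    refine ⟨g, hg, hxg, fun t ℓ hℓ => le_trans ?_ (hdec t ℓ hℓ)⟩
    refine eLpNorm_le_eLpNorm_of_exponent_le (ENNReal.ofReal_le_ofReal hqp) ?_
    exact ((hg.comp ((hx.iid.measurable_innovationPast _).comp measurable_fst)).sub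
        (hg.comp (hx.iid.measurable_coupledPast _ _))).aestronglyMeasurable

theorem eLpNorm_mul_le_half {Ω : Type*} [MeasurableSpace Ω] {P : Measure Ω} {p : ℝ} (hp : 0 < p)
    {x y : Ω → ℝ} (hx : Measurable x) (hy : Measurable y) :
    eLpNorm (fun ω => x ω * y ω) (ENNReal.ofReal (p / 2)) P ≤
      eLpNorm x (ENNReal.ofReal p) P * eLpNorm y (ENNReal.ofReal p) P := by
  have : ENNReal.HolderTriple (ENNReal.ofReal p) (ENNReal.ofReal p) (ENNReal.ofReal (p / 2)) := by
    constructor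
    rw [← ENNReal.ofReal_inv_of_pos hp, ← ENNReal.ofReal_inv_of_pos (by positivity),
      ← ENNReal.ofReal_add (by positivity) (by positivity)]
    congr 1
    field_simp; norm_num
  exact eLpNorm_smul_le_mul_eLpNorm (φ := x) (f := y) hy.aestronglyMeasurable
    hx.aestronglyMeasurable

/-- Products of decomposable shifts with common innovations are decomposable, with half the
number of moments, by `x y - x* y* = x (y - y*) + (x - x*) y*` and Hölder's inequality. -/
theorem IsDecomposableShift.mul [IsProbabilityMeasure P] {x y : ℤ → Ω → ℝ}
    {p a₁ c₁ a₂ c₂ b₁ b₂ : ℝ} (hp : 2 ≤ p)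
    (hx : IsDecomposableShift P η x p a₁ c₁) (hy : IsDecomposableShift P η y p a₂ c₂)
    (hb₁ : 0 ≤ b₁) (hb₂ : 0 ≤ b₂)
    (hxb : ∀ t, eLpNorm (x t) (ENNReal.ofReal p) P ≤ ENNReal.ofReal b₁)
    (hyb : ∀ t, eLpNorm (y t) (ENNReal.ofReal p) P ≤ ENNReal.ofReal b₂) :
    IsDecomposableShift P η (fun t ω => x t ω * y t ω) (p / 2) (min a₁ a₂)
      (b₁ * c₂ + c₁ * (b₂ + c₂)) := by
  have hp0 : 0 < p := by linarith
  have hc₁ := hx.c_pos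
  have hc₂ := hy.c_pos
  refine ⟨lt_min hx.a_pos hy.a_pos, by positivity, hx.iid, fun t => ?_, ?_⟩
  · refine ⟨((hx.measurable t).mul (hy.measurable t)).aestronglyMeasurable, ?_⟩
    refine (eLpNorm_mul_le_half hp0 (hx.measurable t) (hy.measurable t)).trans_lt ?_
    exact ENNReal.mul_lt_top (hx.memLp t).2 (hy.memLp t).2
  obtain ⟨g, hg, hxg, hdx⟩ := hx.exists_shift
  obtain ⟨h, hh, hyh, hdy⟩ := hy.exists_shift
  have hη := hx.iid
  refine ⟨fun z => g z * h z, hg.mul hh, fun t ω => by rw [hxg, hyh], fun t ℓ hℓ => ?_⟩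
  have hℓ1 : (1 : ℝ) ≤ ℓ := by exact_mod_cast hℓ
  have hX : Measurable fun q : Ω × Ω => g (innovationPast η t q.1) :=
    hg.comp ((hη.measurable_innovationPast t).comp measurable_fst)
  have hY : Measurable fun q : Ω × Ω => h (innovationPast η t q.1) :=
    hh.comp ((hη.measurable_innovationPast t).comp measurable_fst)
  have hX' : Measurable fun q : Ω × Ω => g (coupledPast η t ℓ q) :=
    hg.comp (hη.measurable_coupledPast t ℓ)
  have hY' : Measurable fun q : Ω × Ω => h (coupledPast η t ℓ q) :=
    hh.comp (hη.measurable_coupledPast t ℓ)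
  set r : ℝ := (ℓ : ℝ) ^ (-min a₁ a₂) with hr
  have hr0 : 0 ≤ r := by positivity
  have hra₁ : (ℓ : ℝ) ^ (-a₁) ≤ r :=
    Real.rpow_le_rpow_of_exponent_le hℓ1 (neg_le_neg (min_le_left _ _))
  have hra₂ : (ℓ : ℝ) ^ (-a₂) ≤ r :=
    Real.rpow_le_rpow_of_exponent_le hℓ1 (neg_le_neg (min_le_right _ _))
  have hr1 : r ≤ 1 := Real.rpow_le_one_of_one_le_of_nonpos hℓ1
    (neg_nonpos.2 (lt_min hx.a_pos hy.a_pos).le)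
  have hdx' := (hdx t ℓ hℓ).trans
    (ENNReal.ofReal_le_ofReal (mul_le_mul_of_nonneg_left hra₁ hc₁.le))
  have hdy' := (hdy t ℓ hℓ).trans
    (ENNReal.ofReal_le_ofReal (mul_le_mul_of_nonneg_left hra₂ hc₂.le))
  have hXb : eLpNorm (fun q : Ω × Ω => g (innovationPast η t q.1)) (ENNReal.ofReal p) (P.prod P) ≤
      ENNReal.ofReal b₁ := by
    refine le_trans (le_of_eq ?_) (hxb t)
    rw [← eLpNorm_comp_fst (hx.measurable t)]
    simp only [hxg]
  have hYb : eLpNorm (fun q : Ω × Ω => h (innovationPast η t q.1)) (ENNReal.ofReal p) (P.prod P) ≤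
      ENNReal.ofReal b₂ := by
    refine le_trans (le_of_eq ?_) (hyb t)
    rw [← eLpNorm_comp_fst (hy.measurable t)]
    simp only [hyh]
  have hYb' : eLpNorm (fun q : Ω × Ω => h (coupledPast η t ℓ q)) (ENNReal.ofReal p) (P.prod P) ≤
      ENNReal.ofReal (b₂ + c₂) := by
    have : (fun q : Ω × Ω => h (coupledPast η t ℓ q)) =
        (fun q : Ω × Ω => h (innovationPast η t q.1)) -
          fun q => h (innovationPast η t q.1) - h (coupledPast η t ℓ q) := by
      funext q; simp
    rw [this, ENNReal.ofReal_add hb₂ hc₂.le]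
    refine (eLpNorm_sub_le hY.aestronglyMeasurable (hY.sub hY').aestronglyMeasurable
      (by rw [ENNReal.one_le_ofReal]; linarith)).trans (add_le_add hYb (hdy'.trans ?_))
    exact ENNReal.ofReal_le_ofReal (mul_le_of_le_one_right hc₂.le hr1)
  have heq : (fun q : Ω × Ω => g (innovationPast η t q.1) * h (innovationPast η t q.1) -
      g (coupledPast η t ℓ q) * h (coupledPast η t ℓ q)) =
      (fun q => g (innovationPast η t q.1) *
        (h (innovationPast η t q.1) - h (coupledPast η t ℓ q))) +
      fun q => (g (innovationPast η t q.1) - g (coupledPast η t ℓ q)) *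
        h (coupledPast η t ℓ q) := by
    funext q; simp only [Pi.add_apply]; ring
  rw [heq]
  refine (eLpNorm_add_le (hX.mul (hY.sub hY')).aestronglyMeasurable
    ((hX.sub hX').mul hY').aestronglyMeasurable
    (by rw [ENNReal.one_le_ofReal]; linarith)).trans ?_
  refine (add_le_add
    ((eLpNorm_mul_le_half hp0 hX (hY.sub hY')).trans (mul_le_mul' hXb hdy'))
    ((eLpNorm_mul_le_half hp0 (hX.sub hX') hY').trans (mul_le_mul' hdx' hYb'))).trans ?_
  rw [← ENNReal.ofReal_mul hb₁, ← ENNReal.ofReal_mul (by positivity),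
    ← ENNReal.ofReal_add (by positivity) (by positivity)]
  exact ENNReal.ofReal_le_ofReal (le_of_eq (by ring))

/-- Almost sure rate for the time averages of a family of decomposable shifts around their
means. -/
theorem ae_exists_abs_timeMean_sub_le [IsProbabilityMeasure P] {S : ℕ → Type*}
    [∀ i, MeasurableSpace (S i)] {η : (i : ℕ) → ℤ → Ω → S i} {x : ℕ → ℤ → Ω → ℝ} {p a c b : ℝ}
    (hp : 2 < p) (ha : 1 < a) (hb : 0 ≤ b) (hx : ∀ i, IsDecomposableShift P (η i) (x i) p a c)
    (hxb : ∀ i t, eLpNorm (x i t) (ENNReal.ofReal p) P ≤ ENNReal.ofReal b)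
    (C : ℝ) {θ δ : ℝ} (hθ : θ + p * δ < p / 2) :
    ∀ᵐ ω ∂P, ∃ R, 0 ≤ R ∧ ∀ T : ℕ, 1 ≤ T → ∀ i : ℕ, (i : ℝ) + 1 ≤ C * (T : ℝ) ^ θ →
      |timeMean T (fun t => x i t ω) - ∫ ω, x i 0 ω ∂P| ≤ R * (T : ℝ) ^ (-δ) := by
  have hp1 : (1 : ℝ≥0∞) ≤ ENNReal.ofReal p := by rw [ENNReal.one_le_ofReal]; linarith
  have hint : ∀ i t, Integrable (x i t) P := fun i t => ((hx i).memLp t).integrable hp1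
  have hc : 0 < c := (hx 0).c_pos
  have hmean : ∀ i, ‖∫ ω, x i 0 ω ∂P‖ₑ ≤ ENNReal.ofReal b := by
    intro i
    refine (enorm_integral_le_lintegral_enorm _).trans ?_
    rw [← eLpNorm_one_eq_lintegral_enorm]
    exact (eLpNorm_le_eLpNorm_of_exponent_le hp1
      ((hx i).measurable 0).aestronglyMeasurable).trans (hxb i 0)
  have hsum : 0 ≤ ∑' ℓ : ℕ, ((ℓ : ℝ) + 1) ^ (-a) := tsum_nonneg fun ℓ => by positivity
  have key := ae_exists_abs_timeMean_le (P := P) hp (c := c * ∑' ℓ : ℕ, ((ℓ : ℝ) + 1) ^ (-a))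
    (b := b + b) (by positivity) (by positivity)
    (x := fun i t ω => x i t ω - ∫ ω, x i 0 ω ∂P)
    (fun i => ((hx i).sub_const _).hasDecoupledBlocks (by linarith) ha) ?_ ?_ C hθ
  · filter_upwards [key] with ω ⟨R, hR, h⟩
    refine ⟨R, hR, fun T hT i hi => ?_⟩
    have hT0 : (T : ℝ) ≠ 0 := by
      have : T ≠ 0 := by omega
      exact_mod_cast this
    have hsub : timeMean T (fun t => x i t ω - ∫ ω, x i 0 ω ∂P) =
        timeMean T (fun t => x i t ω) - ∫ ω, x i 0 ω ∂P := by
      simp only [timeMean, Finset.sum_sub_distrib, Finset.sum_const, Int.card_Icc, nsmul_eq_mul]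
      rw [mul_sub]
      congr 1
      simp [hT0]
    rw [← hsub]
    exact h T hT i hi
  · intro i t
    refine (eLpNorm_sub_le ((hx i).measurable t).aestronglyMeasurable
      aestronglyMeasurable_const hp1).trans ?_
    rw [ENNReal.ofReal_add hb hb]
    refine add_le_add (hxb i t) ?_
    rw [eLpNorm_const _ (by simpa using by linarith) (IsProbabilityMeasure.ne_zero P)]
    simpa using hmean i
  · intro i t
    rw [integral_sub (hint i t) (integrable_const _), ((hx i).identDistrib t).integral_eq]
    simp

end Transformations

/-! ### The least squares estimators along a path -/

section LeastSquares

theorem timeMean_add (T : ℕ) (y z : ℤ → ℝ) :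
    timeMean T (fun t => y t + z t) = timeMean T y + timeMean T z := by
  simp only [timeMean, Finset.sum_add_distrib, mul_add]

theorem timeMean_sub (T : ℕ) (y z : ℤ → ℝ) :
    timeMean T (fun t => y t - z t) = timeMean T y - timeMean T z := by
  simp only [timeMean, Finset.sum_sub_distrib, mul_sub]

theorem timeMean_const_mul (T : ℕ) (c : ℝ) (z : ℤ → ℝ) :
    timeMean T (fun t => c * z t) = c * timeMean T z := by
  simp only [timeMean, ← Finset.mul_sum]
  ring

theorem timeMean_sum {ι : Type*} (T : ℕ) (s : Finset ι) (z : ι → ℤ → ℝ) :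
    timeMean T (fun t => ∑ k ∈ s, z k t) = ∑ k ∈ s, timeMean T (z k) := by
  simp only [timeMean]
  rw [Finset.sum_comm, Finset.mul_sum]

theorem timeMean_const {T : ℕ} (hT : 1 ≤ T) (c : ℝ) : timeMean T (fun _ => c) = c := by
  have : (T : ℝ) ≠ 0 := by
    have : T ≠ 0 := by omega
    exact_mod_cast this
  simp [timeMean, this]

theorem timeMean_mono (T : ℕ) {y z : ℤ → ℝ} (h : ∀ t, y t ≤ z t) : timeMean T y ≤ timeMean T z :=
  mul_le_mul_of_nonneg_left (Finset.sum_le_sum fun t _ => h t) (by positivity)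

theorem sum_eq_mul_timeMean {T : ℕ} (hT : 1 ≤ T) (z : ℤ → ℝ) :
    ∑ t ∈ Finset.Icc (1 : ℤ) T, z t = T * timeMean T z := by
  have : (T : ℝ) ≠ 0 := by
    have : T ≠ 0 := by omega
    exact_mod_cast this
  rw [timeMean, ← mul_assoc, mul_inv_cancel₀ this, one_mul]

variable {K : ℕ}

/-- Centring one factor of a product: `∑ (f_k - f̄_k) z` is `T` times the sample covariance. -/
theorem sum_sub_factorMean_mul {T : ℕ} (hT : 1 ≤ T) (f : ℤ → EuclideanSpace ℝ (Fin K))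
    (z : ℤ → ℝ) (k : Fin K) :
    ∑ t ∈ Finset.Icc (1 : ℤ) T, (f t k - factorMean T f k) * z t =
      T * (timeMean T (fun t => f t k * z t) - factorMean T f k * timeMean T z) := by
  rw [sum_eq_mul_timeMean hT]
  simp only [sub_mul, timeMean_sub, timeMean_const_mul]

theorem factorScatter_apply {T : ℕ} (hT : 1 ≤ T) (f : ℤ → EuclideanSpace ℝ (Fin K))
    (k l : Fin K) :
    factorScatter T f k l =
      T * (timeMean T (fun t => f t k * f t l) - factorMean T f k * factorMean T f l) := by
  simp only [factorScatter, Matrix.of_apply]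
  rw [sum_sub_factorMean_mul hT f (fun t => f t l - factorMean T f l) k]
  simp only [mul_sub, timeMean_sub, timeMean_const hT]
  have : timeMean T (fun t => f t k * factorMean T f l) =
      factorMean T f k * factorMean T f l := by
    have := timeMean_const_mul T (factorMean T f l) (fun t => f t k)
    simp only [mul_comm (factorMean T f l)] at this
    exact this
  rw [this]
  change _ = (T : ℝ) * _ - _
  simp only [factorMean]
  ring

/-- The sample covariance matrix of the factors. -/
noncomputable def sampleCov (T : ℕ) (f : ℤ → EuclideanSpace ℝ (Fin K)) :
    Matrix (Fin K) (Fin K) ℝ :=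
  Matrix.of fun k l =>
    timeMean T (fun t => f t k * f t l) - factorMean T f k * factorMean T f l

theorem factorScatter_eq_smul {T : ℕ} (hT : 1 ≤ T) (f : ℤ → EuclideanSpace ℝ (Fin K)) :
    factorScatter T f = (T : ℝ) • sampleCov T f := by
  ext k l
  simp [factorScatter_apply hT, sampleCov]

theorem betaHat_sub {T : ℕ} (hT : 1 ≤ T) (f : ℤ → EuclideanSpace ℝ (Fin K))
    (hdet : (sampleCov T f).det ≠ 0) (α : ℕ → ℝ) (β : ℕ → Fin K → ℝ) (u : ℕ → ℤ → ℝ) (i : ℕ)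
    (k : Fin K) :
    betaHat T f (returns α β f u i) k - β i k = ∑ l, (sampleCov T f)⁻¹ k l *
      (timeMean T (fun t => f t l * u i t) - factorMean T f l * timeMean T (u i)) := by
  have hT0 : (T : ℝ) ≠ 0 := by
    have : T ≠ 0 := by omega
    exact_mod_cast this
  have hcross : (fun k => ∑ t ∈ Finset.Icc (1 : ℤ) T, (f t k - factorMean T f k) *
      returns α β f u i t) = (T : ℝ) • (Matrix.mulVec (sampleCov T f) (β i) + fun l =>
        (timeMean T (fun t => f t l * u i t) - factorMean T f l * timeMean T (u i))) := by
    funext k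
    rw [sum_sub_factorMean_mul hT]
    simp only [Pi.smul_apply, Pi.add_apply, smul_eq_mul, Matrix.mulVec, dotProduct, sampleCov,
      Matrix.of_apply]
    congr 1
    have h1 : ∀ t, f t k * returns α β f u i t =
        α i * f t k + ∑ l, β i l * (f t k * f t l) + f t k * u i t := by
      intro t
      simp only [returns, mul_add, Finset.mul_sum]
      congr 2
      · ring
      · exact Finset.sum_congr rfl fun l _ => by ring
    have h2 : timeMean T (returns α β f u i) =
        α i + ∑ l, β i l * factorMean T f l + timeMean T (u i) := by
      have : returns α β f u i = fun t => α i + ∑ k, β i k * f t k + u i t := rfl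
      rw [this]
      simp only [timeMean_add, timeMean_sum, timeMean_const_mul, timeMean_const hT]
      rfl
    simp only [h1, h2, timeMean_add, timeMean_sum, timeMean_const_mul]
    have h3 : timeMean T (fun t => f t k) = factorMean T f k := rfl
    rw [h3, mul_add, mul_add, Finset.mul_sum]
    simp only [sub_mul, Finset.sum_sub_distrib]
    have h4 : ∑ l, β i l * timeMean T (fun t => f t k * f t l) =
      ∑ l, timeMean T (fun t => f t k * f t l) * β i l :=
        Finset.sum_congr rfl fun l _ => mul_comm _ _
    have h5 : ∑ l, factorMean T f k * (β i l * factorMean T f l) =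
      ∑ l, factorMean T f k * factorMean T f l * β i l :=
        Finset.sum_congr rfl fun l _ => by ring
    rw [h4, h5]
    ring
  have hunit : IsUnit (sampleCov T f).det := isUnit_iff_ne_zero.2 hdet
  have hinv : ((T : ℝ) • sampleCov T f)⁻¹ = (T : ℝ)⁻¹ • (sampleCov T f)⁻¹ :=
    Matrix.inv_eq_left_inv (by
      rw [Matrix.smul_mul, Matrix.mul_smul, smul_smul, inv_mul_cancel₀ hT0, one_smul,
        Matrix.nonsing_inv_mul _ hunit])
  have hbeta : betaHat T f (returns α β f u i) = β i + Matrix.mulVec (sampleCov T f)⁻¹ fun l =>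
      (timeMean T (fun t => f t l * u i t) - factorMean T f l * timeMean T (u i)) := by
    rw [betaHat, hcross, factorScatter_eq_smul hT, hinv, Matrix.smul_mulVec, Matrix.mulVec_smul,
      smul_smul, inv_mul_cancel₀ hT0, one_smul, Matrix.mulVec_add, Matrix.mulVec_mulVec,
      Matrix.nonsing_inv_mul _ hunit, Matrix.one_mulVec]
  rw [hbeta]
  simp [Matrix.mulVec, dotProduct]

theorem alphaHat_sub {T : ℕ} (hT : 1 ≤ T) (f : ℤ → EuclideanSpace ℝ (Fin K)) (α : ℕ → ℝ)
    (β : ℕ → Fin K → ℝ) (u : ℕ → ℤ → ℝ) (i : ℕ) :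
    alphaHat T f (returns α β f u i) - α i = timeMean T (u i) -
      ∑ k, (betaHat T f (returns α β f u i) k - β i k) * factorMean T f k := by
  have h2 : timeMean T (returns α β f u i) =
      α i + ∑ l, β i l * factorMean T f l + timeMean T (u i) := by
    have : returns α β f u i = fun t => α i + ∑ k, β i k * f t k + u i t := rfl
    rw [this]
    simp only [timeMean_add, timeMean_sum, timeMean_const_mul, timeMean_const hT]
    rfl
  rw [alphaHat, h2]
  simp only [sub_mul, Finset.sum_sub_distrib]
  ring

theorem olsResidual_eq (T : ℕ) (f : ℤ → EuclideanSpace ℝ (Fin K)) (α : ℕ → ℝ)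
    (β : ℕ → Fin K → ℝ) (u : ℕ → ℤ → ℝ) (i : ℕ) (t : ℤ) :
    olsResidual T f (returns α β f u i) t =
      u i t - ((alphaHat T f (returns α β f u i) - α i) +
        ∑ k, (betaHat T f (returns α β f u i) k - β i k) * f t k) := by
  have : returns α β f u i t = α i + ∑ k, β i k * f t k + u i t := rfl
  rw [olsResidual, this]
  simp only [sub_mul, Finset.sum_sub_distrib]
  ring

theorem sq_add_sum_le (x : ℝ) (z : Fin K → ℝ) :
    (x + ∑ k, z k) ^ 2 ≤ 2 * x ^ 2 + 2 * (K * ∑ k, z k ^ 2) := by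
  have h1 : (∑ k, z k) ^ 2 ≤ K * ∑ k, z k ^ 2 := by
    simpa using sq_sum_le_card_mul_sum_sq (s := Finset.univ) (f := z)
  nlinarith [sq_nonneg (x - ∑ k, z k)]

/-- Deterministic bounds for the least squares estimators: if the sample moments that involve the
errors are at most `e`, and those of the factors are bounded, then the estimation error of alpha is
of order `e`, and the mean squared residual lies between multiples of the mean squared error up to
order `e ^ 2`. -/
theorem exists_leastSquares_bounds (K : ℕ) {L : ℝ} (hL : 0 ≤ L) :
    ∃ B, 0 ≤ B ∧ ∀ (T : ℕ) (_ : 1 ≤ T) (f : ℤ → EuclideanSpace ℝ (Fin K)) (α : ℕ → ℝ)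
      (β : ℕ → Fin K → ℝ) (u : ℕ → ℤ → ℝ) (i : ℕ) (e : ℝ), 0 ≤ e →
      (sampleCov T f).det ≠ 0 → (∀ k l, |(sampleCov T f)⁻¹ k l| ≤ L) →
      (∀ k, |factorMean T f k| ≤ L) → (∀ k, timeMean T (fun t => f t k ^ 2) ≤ L) →
      |timeMean T (u i)| ≤ e → (∀ k, |timeMean T (fun t => f t k * u i t)| ≤ e) →
      |alphaHat T f (returns α β f u i) - α i| ≤ B * e ∧
      timeMean T (fun t => u i t ^ 2) - B * e ^ 2 ≤
        timeMean T (fun t => olsResidual T f (returns α β f u i) t ^ 2) ∧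
      timeMean T (fun t => olsResidual T f (returns α β f u i) t ^ 2) ≤
        2 * timeMean T (fun t => u i t ^ 2) + B * e ^ 2 := by
  set B₁ : ℝ := K * (L * (1 + L)) with hB₁
  set B₂ : ℝ := 1 + K * (B₁ * L) with hB₂
  have hB₁0 : 0 ≤ B₁ := by positivity
  have hB₂0 : 0 ≤ B₂ := by positivity
  refine ⟨B₂ + 2 * (B₂ + K * B₁) + 2 * (2 * B₂ ^ 2 + 2 * (K * (K * (B₁ ^ 2 * L)))),
    by positivity, ?_⟩
  intro T hT f α β u i e he hdet hinv hmean hsq hu hfu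
  set da : ℝ := alphaHat T f (returns α β f u i) - α i with hda
  set db : Fin K → ℝ := fun k => betaHat T f (returns α β f u i) k - β i k with hdb
  have hdbe : ∀ k, |db k| ≤ B₁ * e := by
    intro k
    simp only [hdb]
    rw [betaHat_sub hT f hdet]
    refine (Finset.abs_sum_le_sum_abs _ _).trans ?_
    have : ∀ l ∈ (Finset.univ : Finset (Fin K)), |(sampleCov T f)⁻¹ k l *
        (timeMean T (fun t => f t l * u i t) - factorMean T f l * timeMean T (u i))| ≤
        L * (e + L * e) := by
      intro l _
      rw [abs_mul]
      refine mul_le_mul (hinv k l) ?_ (abs_nonneg _) hL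
      refine (abs_sub _ _).trans (add_le_add (hfu l) ?_)
      rw [abs_mul]
      exact mul_le_mul (hmean l) hu (abs_nonneg _) hL
    refine (Finset.sum_le_sum this).trans (le_of_eq ?_)
    simp [hB₁]; ring
  have hdae : |da| ≤ B₂ * e := by
    rw [hda, alphaHat_sub hT]
    refine (abs_sub _ _).trans ?_
    have h1 : |∑ k, (betaHat T f (returns α β f u i) k - β i k) * factorMean T f k| ≤
        K * (B₁ * e * L) := by
      refine (Finset.abs_sum_le_sum_abs _ _).trans ?_
      have : ∀ k ∈ (Finset.univ : Finset (Fin K)),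
          |(betaHat T f (returns α β f u i) k - β i k) * factorMean T f k| ≤ B₁ * e * L := by
        intro k _
        rw [abs_mul]
        exact mul_le_mul (hdbe k) (hmean k) (abs_nonneg _) (by positivity)
      refine (Finset.sum_le_sum this).trans (le_of_eq ?_)
      simp
    rw [hB₂]
    linarith
  have hres : ∀ t, olsResidual T f (returns α β f u i) t =
      u i t - (da + ∑ k, db k * f t k) := fun t => olsResidual_eq T f α β u i t
  have he2 : 0 ≤ e ^ 2 := by positivity
  refine ⟨hdae.trans (mul_le_mul_of_nonneg_right ?_ he), ?_, ?_⟩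
  · have : 0 ≤ 2 * (B₂ + K * B₁) + 2 * (2 * B₂ ^ 2 + 2 * (K * (K * (B₁ ^ 2 * L)))) := by
      positivity
    linarith
  · have hlow : timeMean T (fun t => u i t ^ 2 +
        ((-2 * da) * u i t + ∑ k, (-2 * db k) * (f t k * u i t))) ≤
        timeMean T (fun t => olsResidual T f (returns α β f u i) t ^ 2) := by
      refine timeMean_mono T fun t => ?_
      rw [hres]
      have : ∑ k, (-2 * db k) * (f t k * u i t) = -2 * (∑ k, db k * f t k) * u i t := by
        rw [Finset.mul_sum, Finset.sum_mul]
        exact Finset.sum_congr rfl fun k _ => by ring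
      rw [this]
      nlinarith [sq_nonneg (da + ∑ k, db k * f t k)]
    simp only [timeMean_add, timeMean_sum, timeMean_const_mul] at hlow
    have h1 : -(2 * B₂ * e ^ 2) ≤ -2 * da * timeMean T (u i) := by
      have : |da * timeMean T (u i)| ≤ B₂ * e * e := by
        rw [abs_mul]; exact mul_le_mul hdae hu (abs_nonneg _) (by positivity)
      have := (abs_le.1 this).2
      nlinarith
    have h2 : -(2 * (K * B₁) * e ^ 2) ≤
        ∑ k, -2 * db k * timeMean T (fun t => f t k * u i t) := by
      have : ∀ k ∈ (Finset.univ : Finset (Fin K)), -(2 * B₁ * e ^ 2) ≤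
          -2 * db k * timeMean T (fun t => f t k * u i t) := by
        intro k _
        have : |db k * timeMean T (fun t => f t k * u i t)| ≤ B₁ * e * e := by
          rw [abs_mul]; exact mul_le_mul (hdbe k) (hfu k) (abs_nonneg _) (by positivity)
        have := (abs_le.1 this).2
        nlinarith
      refine le_trans (le_of_eq ?_) (Finset.sum_le_sum this)
      simp; ring
    have h3 : 0 ≤ (B₂ + 2 * (2 * B₂ ^ 2 + 2 * (K * (K * (B₁ ^ 2 * L))))) * e ^ 2 := by
      positivity
    linarith
  · have hup : timeMean T (fun t => olsResidual T f (returns α β f u i) t ^ 2) ≤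
        timeMean T (fun t => 2 * u i t ^ 2 +
          (4 * da ^ 2 + ∑ k, (4 * K * db k ^ 2) * f t k ^ 2)) := by
      refine timeMean_mono T fun t => ?_
      rw [hres]
      have h1 := sq_add_sum_le da fun k => db k * f t k
      have h2 : ∑ k, (4 * K * db k ^ 2) * f t k ^ 2 = 4 * (K * ∑ k, (db k * f t k) ^ 2) := by
        rw [Finset.mul_sum, Finset.mul_sum]
        exact Finset.sum_congr rfl fun k _ => by ring
      rw [h2]
      nlinarith [sq_nonneg (u i t + (da + ∑ k, db k * f t k))]
    simp only [timeMean_add, timeMean_sum, timeMean_const_mul, timeMean_const hT] at hup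
    have hda2 : da ^ 2 ≤ B₂ ^ 2 * e ^ 2 := by
      rw [← mul_pow, ← sq_abs]; exact pow_le_pow_left₀ (abs_nonneg _) hdae 2
    have h2 : ∑ k, 4 * K * db k ^ 2 * timeMean T (fun t => f t k ^ 2) ≤
        K * (4 * K * (B₁ ^ 2 * e ^ 2) * L) := by
      have : ∀ k ∈ (Finset.univ : Finset (Fin K)),
          4 * K * db k ^ 2 * timeMean T (fun t => f t k ^ 2) ≤
          4 * K * (B₁ ^ 2 * e ^ 2) * L := by
        intro k _
        have hdb2 : db k ^ 2 ≤ B₁ ^ 2 * e ^ 2 := by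
          rw [← mul_pow, ← sq_abs]; exact pow_le_pow_left₀ (abs_nonneg _) (hdbe k) 2
        calc 4 * K * db k ^ 2 * timeMean T (fun t => f t k ^ 2)
            ≤ 4 * K * db k ^ 2 * L := mul_le_mul_of_nonneg_left (hsq k) (by positivity)
          _ ≤ 4 * K * (B₁ ^ 2 * e ^ 2) * L := by gcongr
      refine (Finset.sum_le_sum this).trans (le_of_eq ?_)
      simp
    have h3 : 0 ≤ (B₂ + 2 * (B₂ + K * B₁)) * e ^ 2 := by positivity
    linarith

theorem sHat_eq {N T : ℕ} (f : ℤ → EuclideanSpace ℝ (Fin K)) (y : ℕ → ℤ → ℝ) :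
    sHat N T f y =
      √((N : ℝ)⁻¹ * ∑ i ∈ Finset.range N, timeMean T (fun t => olsResidual T f (y i) t ^ 2)) := by
  rw [sHat]
  congr 1
  simp only [timeMean, ← Finset.mul_sum]
  rw [mul_inv, mul_assoc]

theorem avg_mem_Icc {N : ℕ} (hN : 1 ≤ N) {z : ℕ → ℝ} {lo hi : ℝ}
    (h : ∀ i < N, z i ∈ Set.Icc lo hi) :
    (N : ℝ)⁻¹ * ∑ i ∈ Finset.range N, z i ∈ Set.Icc lo hi := by
  have hN0 : (0 : ℝ) < N := by exact_mod_cast hN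
  rw [inv_mul_eq_div, Set.mem_Icc, le_div_iff₀ hN0, div_le_iff₀ hN0]
  constructor
  · have := Finset.card_nsmul_le_sum (Finset.range N) z lo
      fun i hi' => (h i (Finset.mem_range.1 hi')).1
    simpa [mul_comm] using this
  · have := Finset.sum_le_card_nsmul (Finset.range N) z hi
      fun i hi' => (h i (Finset.mem_range.1 hi')).2
    simpa [mul_comm] using this

end LeastSquares

/-! ### The Gumbel limit for maxima of normal variables -/

section Gumbel

theorem tendsto_exp_neg_sq_div_two : Tendsto (fun t : ℝ => Real.exp (-t ^ 2 / 2)) atTop (𝓝 0) := by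
  refine Real.tendsto_exp_atBot.comp ?_
  have : (fun t : ℝ => -t ^ 2 / 2) = fun t => -(t ^ 2 / 2) := by funext t; ring
  rw [this]
  exact tendsto_neg_atTop_atBot.comp
    ((tendsto_pow_atTop (by norm_num)).atTop_div_const (by norm_num))

theorem hasDerivAt_exp_neg_sq_div_two (t : ℝ) :
    HasDerivAt (fun t : ℝ => Real.exp (-t ^ 2 / 2)) (-t * Real.exp (-t ^ 2 / 2)) t := by
  have h : HasDerivAt (fun t : ℝ => -t ^ 2 / 2) (-t) t := by
    have := ((hasDerivAt_pow 2 t).neg).div_const 2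
    convert! this using 1
    simp; ring
  convert! h.exp using 1
  ring

theorem integrableOn_exp_neg_sq_div_two (z : ℝ) :
    IntegrableOn (fun t : ℝ => Real.exp (-t ^ 2 / 2)) (Set.Ioi z) := by
  have := (integrable_exp_neg_mul_sq (b := 1 / 2) (by norm_num)).integrableOn (s := Set.Ioi z)
  refine this.congr_fun (fun t _ => ?_) measurableSet_Ioi
  simp only
  congr 1; ring

theorem integral_Ioi_exp_neg_sq_le {z : ℝ} (hz : 0 < z) :
    z * ∫ t in Set.Ioi z, Real.exp (-t ^ 2 / 2) ≤ Real.exp (-z ^ 2 / 2) := by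
  have hd : ∀ t ∈ Set.Ici z, HasDerivAt (fun t : ℝ => -Real.exp (-t ^ 2 / 2))
      (t * Real.exp (-t ^ 2 / 2)) t := fun t _ => by
    convert! (hasDerivAt_exp_neg_sq_div_two t).neg using 1; ring
  have hpos : ∀ t ∈ Set.Ioi z, 0 ≤ t * Real.exp (-t ^ 2 / 2) := fun t ht =>
    mul_nonneg (hz.le.trans (le_of_lt ht)) (Real.exp_pos _).le
  have hlim : Tendsto (fun t : ℝ => -Real.exp (-t ^ 2 / 2)) atTop (𝓝 0) := by
    simpa using tendsto_exp_neg_sq_div_two.neg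
  have hval := integral_Ioi_of_hasDerivAt_of_nonneg' hd hpos hlim
  have hint := integrableOn_Ioi_deriv_of_nonneg' hd hpos hlim
  rw [← integral_const_mul]
  refine (setIntegral_mono_on ((integrableOn_exp_neg_sq_div_two z).const_mul z) hint
    measurableSet_Ioi fun t ht => ?_).trans (le_of_eq (by rw [hval]; ring))
  exact mul_le_mul_of_nonneg_right (le_of_lt ht) (Real.exp_pos _).le

theorem le_integral_Ioi_exp_neg_sq {z : ℝ} (hz : 0 < z) :
    Real.exp (-z ^ 2 / 2) / z ≤
      (1 + 1 / z ^ 2) * ∫ t in Set.Ioi z, Real.exp (-t ^ 2 / 2) := by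
  have hd : ∀ t ∈ Set.Ici z, HasDerivAt (fun t : ℝ => -(Real.exp (-t ^ 2 / 2) / t))
      ((1 + 1 / t ^ 2) * Real.exp (-t ^ 2 / 2)) t := fun t ht => by
    have ht0 : t ≠ 0 := (hz.trans_le ht).ne'
    convert! ((hasDerivAt_exp_neg_sq_div_two t).div (hasDerivAt_id t) ht0).neg using 1
    simp only [id]
    field_simp
    ring
  have hpos : ∀ t ∈ Set.Ioi z, 0 ≤ (1 + 1 / t ^ 2) * Real.exp (-t ^ 2 / 2) := fun t _ => by
    positivity
  have hlim : Tendsto (fun t : ℝ => -(Real.exp (-t ^ 2 / 2) / t)) atTop (𝓝 0) := by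
    simpa using (tendsto_exp_neg_sq_div_two.div_atTop tendsto_id).neg
  have hval := integral_Ioi_of_hasDerivAt_of_nonneg' hd hpos hlim
  have hint := integrableOn_Ioi_deriv_of_nonneg' hd hpos hlim
  rw [← integral_const_mul]
  refine (le_of_eq (by rw [hval]; ring)).trans (setIntegral_mono_on hint
    ((integrableOn_exp_neg_sq_div_two z).const_mul _) measurableSet_Ioi fun t ht => ?_)
  have : z ≤ t := le_of_lt ht
  gcongr

/-- Mills' ratio of the standard normal law. -/
theorem tendsto_millsRatio :
    Tendsto (fun z : ℝ => z * (∫ t in Set.Ioi z, Real.exp (-t ^ 2 / 2)) / Real.exp (-z ^ 2 / 2))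
      atTop (𝓝 1) := by
  have hlow : Tendsto (fun z : ℝ => (1 + 1 / z ^ 2)⁻¹) atTop (𝓝 1) := by
    have h1 : Tendsto (fun z : ℝ => 1 / z ^ 2) atTop (𝓝 0) :=
      tendsto_const_nhds.div_atTop (tendsto_pow_atTop (by norm_num))
    have h2 := (h1.const_add 1).inv₀ (by norm_num)
    simpa using h2
  refine tendsto_of_tendsto_of_tendsto_of_le_of_le' hlow tendsto_const_nhds ?_ ?_
  · filter_upwards [eventually_gt_atTop 0] with z hz
    have h := le_integral_Ioi_exp_neg_sq hz
    rw [inv_le_iff_one_le_mul₀ (by positivity), div_mul_eq_mul_div,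
      le_div_iff₀ (Real.exp_pos _)]
    rw [div_le_iff₀ hz] at h
    linarith
  · filter_upwards [eventually_gt_atTop 0] with z hz
    rw [div_le_one (Real.exp_pos _)]
    exact integral_Ioi_exp_neg_sq_le hz

theorem gaussianReal_Ioi (z : ℝ) : (gaussianReal 0 1).real (Set.Ioi z) =
    (√(2 * Real.pi))⁻¹ * ∫ t in Set.Ioi z, Real.exp (-t ^ 2 / 2) := by
  rw [Measure.real, gaussianReal_apply_eq_integral _ one_ne_zero,
    ENNReal.toReal_ofReal (integral_nonneg fun t => gaussianPDFReal_nonneg _ _ _),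
    ← integral_const_mul]
  simp [gaussianPDFReal]

theorem gaussianReal_Iic (z : ℝ) : (gaussianReal 0 1).real (Set.Iic z) =
    1 - (gaussianReal 0 1).real (Set.Ioi z) := by
  have := probReal_compl_eq_one_sub (μ := gaussianReal 0 1) (measurableSet_Ioi (a := z))
  rwa [Set.compl_Ioi] at this

theorem gumbelB_eq {n : ℕ} (hL : 0 < Real.log n) :
    gumbelB n = √(2 * Real.log n) * (1 - Real.log (4 * Real.pi * Real.log n) /
      (4 * Real.log n)) := by
  have hpi := Real.pi_pos
  have hs : √(2 * Real.log n) ≠ 0 := by positivity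
  have hsq : √(2 * Real.log n) ^ 2 = 2 * Real.log n := Real.sq_sqrt (by positivity)
  rw [gumbelB, ← Real.log_mul hL.ne' (by positivity),
    mul_comm (Real.log n) (4 * Real.pi), mul_sub, mul_one]
  congr 1
  rw [div_eq_iff (by positivity)]
  generalize Real.log (4 * Real.pi * Real.log n) = r
  calc r = 2 * Real.log n * (r / (2 * Real.log n)) := by field_simp
    _ = √(2 * Real.log n) ^ 2 * (r / (2 * Real.log n)) := by rw [hsq]
    _ = _ := by ring

theorem tendsto_log_nat_atTop : Tendsto (fun n : ℕ => Real.log n) atTop atTop :=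
  Real.tendsto_log_atTop.comp tendsto_natCast_atTop_atTop

theorem tendsto_log_pow_div (j : ℕ) :
    Tendsto (fun n : ℕ => Real.log (4 * Real.pi * Real.log n) ^ j / Real.log n) atTop (𝓝 0) := by
  have hpi := Real.pi_pos
  have h1 : Tendsto (fun n : ℕ => 4 * Real.pi * Real.log n) atTop atTop :=
    tendsto_log_nat_atTop.const_mul_atTop (by positivity)
  have h2 := (Real.isLittleO_pow_log_id_atTop (n := j)).tendsto_div_nhds_zero.comp h1
  have h3 := h2.const_mul (4 * Real.pi)
  rw [mul_zero] at h3
  refine h3.congr fun n => ?_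
  simp only [Function.comp, id]
  rw [← mul_div_assoc, mul_div_mul_left _ _ (by positivity)]

theorem tendsto_gumbelB_div_sqrt :
    Tendsto (fun n : ℕ => gumbelB n / √(2 * Real.log n)) atTop (𝓝 1) := by
  have h := ((tendsto_log_pow_div 1).const_mul (1 / 4)).const_sub 1
  simp only [mul_zero, sub_zero, pow_one] at h
  refine h.congr' ?_
  filter_upwards [tendsto_log_nat_atTop.eventually_gt_atTop 0] with n hL
  have hs : √(2 * Real.log n) ≠ 0 := by positivity
  rw [gumbelB_eq hL]
  field_simp

theorem tendsto_sqrt_two_log : Tendsto (fun n : ℕ => √(2 * Real.log n)) atTop atTop :=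
  Real.tendsto_sqrt_atTop.comp (tendsto_log_nat_atTop.const_mul_atTop (by norm_num))

theorem tendsto_gumbelB : Tendsto gumbelB atTop atTop := by
  have h := tendsto_gumbelB_div_sqrt.pos_mul_atTop one_pos tendsto_sqrt_two_log
  refine h.congr' ?_
  filter_upwards [tendsto_log_nat_atTop.eventually_gt_atTop 0] with n hL
  have hs : √(2 * Real.log n) ≠ 0 := by positivity
  field_simp

theorem tendsto_gumbelA_mul_gumbelB : Tendsto (fun n => gumbelA n * gumbelB n) atTop (𝓝 1) := by
  have h1 : Tendsto (fun n => 1 / (1 + gumbelB n ^ 2)) atTop (𝓝 0) :=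
    tendsto_const_nhds.div_atTop (tendsto_atTop_add_const_left _ 1
      ((tendsto_pow_atTop (by norm_num)).comp tendsto_gumbelB))
  have h2 := h1.const_sub 1
  rw [sub_zero] at h2
  refine h2.congr fun n => ?_
  have : (1 + gumbelB n ^ 2) ≠ 0 := by positivity
  rw [gumbelA]
  field_simp
  ring

theorem tendsto_gumbelA : Tendsto gumbelA atTop (𝓝 0) := by
  have h := tendsto_gumbelA_mul_gumbelB.div_atTop tendsto_gumbelB
  refine h.congr' ?_
  filter_upwards [tendsto_gumbelB.eventually_gt_atTop 0] with n hn
  field_simp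

/-- The centring `b_n` is chosen so that `n` times the normal density at `b_n + a_n x` is
`√(2 log n)` times a factor that tends to `e^{-x}`. -/
theorem nat_mul_exp_neg_sq_eq {n : ℕ} (hL : 0 < Real.log n) (hn : n ≠ 0) (x : ℝ) :
    n * ((√(2 * Real.pi))⁻¹ * Real.exp (-(gumbelB n + gumbelA n * x) ^ 2 / 2)) =
      √(2 * Real.log n) * Real.exp (-(Real.log (4 * Real.pi * Real.log n) ^ 2 / Real.log n) / 16 -
        gumbelA n * gumbelB n * x - (gumbelA n * x) ^ 2 / 2) := by
  have hpi := Real.pi_pos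
  set L := Real.log n with hLdef
  set r := Real.log (4 * Real.pi * L) with hr
  have hsq : √(2 * L) ^ 2 = 2 * L := Real.sq_sqrt (by positivity)
  have hb2 : gumbelB n ^ 2 = 2 * L - r + r ^ 2 / (8 * L) := by
    rw [gumbelB_eq hL, mul_pow, ← hLdef, hsq, ← hr]
    field_simp
    ring
  have hexp : Real.exp (-(gumbelB n + gumbelA n * x) ^ 2 / 2) =
      Real.exp (-L) * Real.exp (r / 2) * Real.exp (-(r ^ 2 / L) / 16 -
        gumbelA n * gumbelB n * x - (gumbelA n * x) ^ 2 / 2) := by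
    rw [← Real.exp_add, ← Real.exp_add]
    congr 1
    have : (gumbelB n + gumbelA n * x) ^ 2 = gumbelB n ^ 2 +
        2 * (gumbelA n * gumbelB n * x) + (gumbelA n * x) ^ 2 := by ring
    rw [this, hb2]
    field_simp
    ring
  have hn1 : (n : ℝ) * Real.exp (-L) = 1 := by
    have hn0 : (0 : ℝ) < n := by
      have := Nat.pos_of_ne_zero hn
      exact_mod_cast this
    rw [Real.exp_neg, hLdef, Real.exp_log hn0, mul_inv_cancel₀ hn0.ne']
  have hrexp : Real.exp (r / 2) = √(2 * Real.pi) * √(2 * L) := by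
    rw [← Real.sqrt_mul (by positivity), Real.exp_half, hr, Real.exp_log (by positivity)]
    congr 1; ring
  have hs : √(2 * Real.pi) ≠ 0 := by positivity
  rw [hexp, hrexp]
  calc _ = ((n : ℝ) * Real.exp (-L)) * ((√(2 * Real.pi))⁻¹ * √(2 * Real.pi)) * (√(2 * L) *
        Real.exp (-(r ^ 2 / L) / 16 - gumbelA n * gumbelB n * x - (gumbelA n * x) ^ 2 / 2)) := by
        ring
    _ = _ := by rw [hn1, inv_mul_cancel₀ hs]; ring

theorem tendsto_gumbelB_add (x : ℝ) :
    Tendsto (fun n => gumbelB n + gumbelA n * x) atTop atTop :=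
  tendsto_gumbelB.atTop_add (tendsto_gumbelA.mul_const x)

theorem tendsto_nat_mul_normalTail (x : ℝ) :
    Tendsto (fun n : ℕ => n * (gaussianReal 0 1).real (Set.Ioi (gumbelB n + gumbelA n * x))) atTop
      (𝓝 (Real.exp (-x))) := by
  have hz := tendsto_gumbelB_add x
  have hmills := tendsto_millsRatio.comp hz
  have hratio : Tendsto (fun n : ℕ => (gumbelB n + gumbelA n * x) / √(2 * Real.log n)) atTop
      (𝓝 1) := by
    have h := tendsto_gumbelB_div_sqrt.add
      ((tendsto_gumbelA.mul_const x).div_atTop tendsto_sqrt_two_log)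
    simp only [add_zero] at h
    refine h.congr fun n => ?_
    rw [add_div]
  have hexp : Tendsto (fun n : ℕ => Real.exp (-(Real.log (4 * Real.pi * Real.log n) ^ 2 /
      Real.log n) / 16 - gumbelA n * gumbelB n * x - (gumbelA n * x) ^ 2 / 2)) atTop
      (𝓝 (Real.exp (-x))) := by
    refine (Real.continuous_exp.tendsto _).comp ?_
    have h := (((tendsto_log_pow_div 2).neg.div_const 16).sub
      (tendsto_gumbelA_mul_gumbelB.mul_const x)).sub
      (((tendsto_gumbelA.mul_const x).pow 2).div_const 2)
    convert h using 2
    simp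
  have h := (hmills.mul (hratio.inv₀ one_ne_zero)).mul hexp
  simp only [inv_one, one_mul, mul_one] at h
  refine h.congr' ?_
  filter_upwards [hz.eventually_gt_atTop 0, tendsto_log_nat_atTop.eventually_gt_atTop 0,
    eventually_ne_atTop 0] with n hn hL hn0
  have hs : √(2 * Real.log n) ≠ 0 := by positivity
  have hkey := nat_mul_exp_neg_sq_eq hL hn0 x
  rw [gaussianReal_Ioi]
  simp only [Function.comp]
  set z := gumbelB n + gumbelA n * x
  set E := Real.exp (-(Real.log (4 * Real.pi * Real.log n) ^ 2 /
      Real.log n) / 16 - gumbelA n * gumbelB n * x - (gumbelA n * x) ^ 2 / 2)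
  have hE : E = n * ((√(2 * Real.pi))⁻¹ * Real.exp (-z ^ 2 / 2)) / √(2 * Real.log n) := by
    rw [hkey]; field_simp
  rw [hE]
  have hg : Real.exp (-z ^ 2 / 2) ≠ 0 := (Real.exp_pos _).ne'
  have hpi : √(2 * Real.pi) ≠ 0 := by have := Real.pi_pos; positivity
  field_simp

/-- The law of the maximum of `n` independent standard normal variables, centred by `b_n` and
scaled by `a_n`, converges to the Gumbel law. -/
theorem tendsto_normalCDF_pow (x : ℝ) :
    Tendsto (fun n : ℕ => (gaussianReal 0 1).real (Set.Iic (gumbelB n + gumbelA n * x)) ^ n) atTop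
      (𝓝 (Real.exp (-Real.exp (-x)))) := by
  have h := Real.tendsto_one_add_pow_exp_of_tendsto
    (g := fun n => -(gaussianReal 0 1).real (Set.Ioi (gumbelB n + gumbelA n * x)))
    (t := -Real.exp (-x)) (by simpa using (tendsto_nat_mul_normalTail x).neg)
  refine h.congr fun n => ?_
  rw [gaussianReal_Iic, sub_eq_add_neg]

end Gumbel

/-! ### The conditional law of the statistic given the sample -/

section ConditionalLaw

variable {Ω : Type*} [MeasurableSpace Ω] {P : Measure Ω}

/-- The conditional law of a function of two independent variables given the first one is obtained
by freezing that variable. -/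
theorem condDistrib_ae_eq_of_indepFun {β γ : Type*} [MeasurableSpace β] [MeasurableSpace γ]
    [IsProbabilityMeasure P] {X : Ω → β} {W : Ω → γ} (hX : Measurable X) (hW : Measurable W)
    (h : IndepFun W X P) {F : β × γ → ℝ} (hF : Measurable F) :
    ∀ᵐ ω ∂P, condDistrib (fun ω => F (X ω, W ω)) X P (X ω) =
      (P.map W).map (fun w => F (X ω, w)) := by
  have := Measure.isProbabilityMeasure_map (μ := P) hW.aemeasurable
  have := Measure.isProbabilityMeasure_map (μ := P) hX.aemeasurable
  set κ : Kernel β ℝ := (Kernel.id ×ₖ Kernel.const β (P.map W)).map F with hκ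
  have : IsMarkovKernel κ := Kernel.IsMarkovKernel.map _ hF
  have hκs : ∀ s, κ s = (P.map W).map fun w => F (s, w) := by
    intro s
    rw [hκ, Kernel.map_apply _ hF, Kernel.prod_apply, Kernel.id_apply, Kernel.const_apply,
      Measure.dirac_prod, Measure.map_map hF measurable_prodMk_left]
    rfl
  have hY : Measurable fun ω => F (X ω, W ω) := hF.comp (hX.prodMk hW)
  have key : P.map (fun ω => (X ω, F (X ω, W ω))) = P.map X ⊗ₘ κ := by
    ext t ht
    have hG : Measurable fun q : β × γ => (q.1, F q) := measurable_fst.prodMk hF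
    have hind := h.symm.map_prod_eq_prod_map_map hX.aemeasurable hW.aemeasurable
    have h1 : P.map (fun ω => (X ω, F (X ω, W ω))) =
        ((P.map X).prod (P.map W)).map fun q => (q.1, F q) := by
      rw [← hind, Measure.map_map hG (hX.prodMk hW)]
      rfl
    rw [h1, Measure.map_apply hG ht, Measure.prod_apply (hG ht), Measure.compProd_apply ht]
    refine lintegral_congr fun s => ?_
    have hFs : Measurable fun w => F (s, w) := hF.comp measurable_prodMk_left
    rw [hκs, Measure.map_apply hFs (measurable_prodMk_left ht)]
    rfl
  have hae := condDistrib_ae_eq_of_measure_eq_compProd X hY.aemeasurable key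
  filter_upwards [ae_of_ae_map hX.aemeasurable hae] with ω hω
  rw [hω, hκs]

theorem measurable_normalizedMax {β : Type*} [MeasurableSpace β] {N : ℕ} {ψ : β → Fin N → ℝ}
    (hψ : ∀ i, Measurable fun s => ψ s i) (a b : ℝ) :
    Measurable fun q : β × (Fin N → ℝ) => ((⨆ i, (ψ q.1 i + q.2 i)) - b) / a := by
  refine Measurable.div_const (Measurable.sub_const (Measurable.iSup fun i => ?_) b) a
  exact ((hψ i).comp measurable_fst).add ((measurable_pi_apply i).comp measurable_snd)

/-- Given the sample, the normalised maximum of shifted independent standard normal variables has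
a product distribution function. -/
theorem condDistrib_normalizedMax {β : Type*} [MeasurableSpace β] [IsProbabilityMeasure P]
    {N : ℕ} (hN : 1 ≤ N) {X : Ω → β} {w : ℕ → Ω → ℝ} (hX : Measurable X)
    (hw_meas : ∀ i, Measurable (w i)) (hw_indep : iIndepFun w P)
    (hw_law : ∀ i, P.map (w i) = gaussianReal 0 1)
    (h : IndepFun (fun ω (i : Fin N) => w i ω) X P) {ψ : β → Fin N → ℝ}
    (hψ : ∀ i, Measurable fun s => ψ s i) {a : ℝ} (ha : 0 < a) (b : ℝ) :
    ∀ᵐ ω ∂P, ∀ x : ℝ,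
      (condDistrib (fun ω => ((⨆ i : Fin N, (ψ (X ω) i + w i ω)) - b) / a) X P (X ω)).real
        (Set.Iic x) = ∏ i, (gaussianReal 0 1).real (Set.Iic (b + a * x - ψ (X ω) i)) := by
  have hW : Measurable fun ω (i : Fin N) => w i ω := measurable_pi_iff.2 fun i => hw_meas i
  have hF := measurable_normalizedMax hψ a b
  have hlaw : P.map (fun ω (i : Fin N) => w i ω) = Measure.pi fun _ => gaussianReal 0 1 := by
    have hind : iIndepFun (fun (i : Fin N) => w i) P :=
      hw_indep.precomp (g := fun i : Fin N => (i : ℕ)) Fin.val_injective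
    have h1 := iIndepFun.map_fun_eq_pi_map (f := fun i : Fin N => w i)
      (fun i => (hw_meas i).aemeasurable) hind
    simpa only [hw_law] using h1
  have : Nonempty (Fin N) := ⟨⟨0, hN⟩⟩
  filter_upwards [condDistrib_ae_eq_of_indepFun hX hW h hF] with ω hω x
  have hset : (fun v : Fin N → ℝ => ((⨆ i, (ψ (X ω) i + v i)) - b) / a) ⁻¹' Set.Iic x =
      Set.univ.pi fun i => Set.Iic (b + a * x - ψ (X ω) i) := by
    ext v
    simp only [Set.mem_preimage, Set.mem_Iic, Set.mem_univ_pi]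
    rw [div_le_iff₀ ha, sub_le_iff_le_add, ciSup_le_iff (Set.finite_range _).bddAbove]
    refine forall_congr' fun i => ?_
    constructor <;> intro h <;> linarith
  have hFω : Measurable fun v : Fin N → ℝ => ((⨆ i, (ψ (X ω) i + v i)) - b) / a :=
    hF.comp measurable_prodMk_left
  rw [hω, hlaw, measureReal_def, Measure.map_apply hFω measurableSet_Iic, hset,
    Measure.pi_pi, ENNReal.toReal_prod]
  rfl

variable {K : ℕ}

theorem measurable_det {n : ℕ} {A : Ω → Matrix (Fin n) (Fin n) ℝ}
    (hA : ∀ i j, Measurable fun ω => A ω i j) : Measurable fun ω => (A ω).det := by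
  simp only [Matrix.det_apply]
  exact Finset.measurable_fun_sum _ fun σ _ =>
    (Finset.measurable_fun_prod _ fun i _ => hA _ _).const_smul _

theorem measurable_matrix_inv {n : ℕ} {A : Ω → Matrix (Fin n) (Fin n) ℝ}
    (hA : ∀ i j, Measurable fun ω => A ω i j) (i j : Fin n) :
    Measurable fun ω => (A ω)⁻¹ i j := by
  simp only [Matrix.inv_def, Matrix.smul_apply, Ring.inverse_eq_inv', smul_eq_mul,
    Matrix.adjugate_apply]
  refine (measurable_det hA).inv.mul (measurable_det fun k l => ?_)
  simp only [Matrix.updateRow_apply]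
  split_ifs
  · exact measurable_const
  · exact hA k l

theorem measurable_timeMean (T : ℕ) {z : ℤ → Ω → ℝ} (hz : ∀ t, Measurable (z t)) :
    Measurable fun ω => timeMean T (fun t => z t ω) :=
  (Finset.measurable_fun_sum _ fun t _ => hz t).const_mul _

theorem measurable_psiStat (ν : ℝ) (N T : ℕ) {f : ℤ → Ω → EuclideanSpace ℝ (Fin K)}
    (hf : ∀ t k, Measurable fun ω => f t ω k) {y : ℕ → ℤ → Ω → ℝ}
    (hy : ∀ i t, Measurable (y i t)) (i : ℕ) :
    Measurable fun ω => psiStat ν N T (fun t => f t ω) (fun i t => y i t ω) i := by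
  have hmean : ∀ k, Measurable fun ω => factorMean T (fun t => f t ω) k := fun k =>
    measurable_timeMean T fun t => hf t k
  have hscatter : ∀ k l, Measurable fun ω => factorScatter T (fun t => f t ω) k l := by
    intro k l
    simp only [factorScatter, Matrix.of_apply]
    exact Finset.measurable_fun_sum _ fun t _ =>
      ((hf t k).sub (hmean k)).mul ((hf t l).sub (hmean l))
  have hbeta : ∀ i k, Measurable fun ω =>
      betaHat T (fun t => f t ω) (fun t => y i t ω) k := by
    intro i k
    simp only [betaHat, Matrix.mulVec, dotProduct]
    exact Finset.measurable_fun_sum _ fun l _ => (measurable_matrix_inv hscatter k l).mul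
      (Finset.measurable_fun_sum _ fun t _ => ((hf t l).sub (hmean l)).mul (hy i t))
  have halpha : ∀ i, Measurable fun ω => alphaHat T (fun t => f t ω) (fun t => y i t ω) := by
    intro i
    exact (measurable_timeMean T (hy i)).sub
      (Finset.measurable_fun_sum _ fun k _ => (hbeta i k).mul (hmean k))
  have hs : Measurable fun ω => sHat N T (fun t => f t ω) (fun i t => y i t ω) := by
    refine Measurable.sqrt (Measurable.const_mul ?_ _)
    refine Finset.measurable_fun_sum _ fun i _ => Finset.measurable_fun_sum _ fun t _ => ?_
    exact (((hy i t).sub (halpha i)).sub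
      (Finset.measurable_fun_sum _ fun k _ => (hbeta i k).mul (hf t k))).pow_const 2
  exact Measurable.pow_const (((halpha i).const_mul _).div hs).abs _

theorem psiStat_congr (ν : ℝ) {N T : ℕ} {f f' : ℤ → EuclideanSpace ℝ (Fin K)}
    {y y' : ℕ → ℤ → ℝ} (hf : ∀ t ∈ Finset.Icc (1 : ℤ) T, f t = f' t)
    (hy : ∀ i < N, ∀ t ∈ Finset.Icc (1 : ℤ) T, y i t = y' i t) {i : ℕ} (hi : i < N) :
    psiStat ν N T f y i = psiStat ν N T f' y' i := by
  have hmean : factorMean T f = factorMean T f' := by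
    funext k
    simp only [factorMean, timeMean]
    rw [Finset.sum_congr rfl fun t ht => by rw [hf t ht]]
  have hscatter : factorScatter T f = factorScatter T f' := by
    ext k l
    simp only [factorScatter, Matrix.of_apply]
    exact Finset.sum_congr rfl fun t ht => by rw [hf t ht, hmean]
  have hbeta : ∀ i < N, betaHat T f (y i) = betaHat T f' (y' i) := by
    intro i hi
    simp only [betaHat, hscatter]
    congr 1
    funext k
    exact Finset.sum_congr rfl fun t ht => by rw [hf t ht, hmean, hy i hi t ht]
  have halpha : ∀ i < N, alphaHat T f (y i) = alphaHat T f' (y' i) := by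
    intro i hi
    simp only [alphaHat, hbeta i hi, hmean, timeMean]
    rw [Finset.sum_congr rfl fun t ht => hy i hi t ht]
  have hs : sHat N T f y = sHat N T f' y' := by
    simp only [sHat]
    congr 2
    refine Finset.sum_congr rfl fun j hj => Finset.sum_congr rfl fun t ht => ?_
    have hj' := Finset.mem_range.1 hj
    simp only [olsResidual, hbeta j hj', halpha j hj', hf t ht, hy j hj' t ht]
  simp only [psiStat, hs, halpha i hi]

/-- `ψ_{i,NT}` as a function of the sample. The paths are set to zero where the sample does not
determine them, which does not affect the statistic. -/
noncomputable def samplePsi {K : ℕ} (ν : ℝ) (α : ℕ → ℝ) (β : ℕ → Fin K → ℝ) (N T : ℕ)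
    (s : (Fin N → Set.Icc (1 : ℤ) (T : ℤ) → ℝ) ×
      (Set.Icc (1 : ℤ) (T : ℤ) → EuclideanSpace ℝ (Fin K))) (i : Fin N) : ℝ :=
  psiStat ν N T (fun t => if h : t ∈ Set.Icc (1 : ℤ) T then s.2 ⟨t, h⟩ else 0)
    (returns α β (fun t => if h : t ∈ Set.Icc (1 : ℤ) T then s.2 ⟨t, h⟩ else 0)
      fun i t => if h : i < N ∧ t ∈ Set.Icc (1 : ℤ) T then s.1 ⟨i, h.1⟩ ⟨t, h.2⟩ else 0) i

theorem samplePsi_sampleNT {Ω : Type*} (ν : ℝ) (α : ℕ → ℝ) (β : ℕ → Fin K → ℝ)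
    (f : ℤ → Ω → EuclideanSpace ℝ (Fin K)) (u : ℕ → ℤ → Ω → ℝ) (N T : ℕ) (ω : Ω) (i : Fin N) :
    samplePsi ν α β N T (sampleNT f u N T ω) i =
      psiStat ν N T (fun t => f t ω) (returns α β (fun t => f t ω) fun i t => u i t ω) i := by
  refine psiStat_congr ν (fun t ht => ?_) (fun j hj t ht => ?_) i.2
  · have ht' : t ∈ Set.Icc (1 : ℤ) T := Finset.mem_Icc.1 ht
    rw [dif_pos ht']
    rfl
  · have ht' : t ∈ Set.Icc (1 : ℤ) T := Finset.mem_Icc.1 ht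
    simp only [returns]
    rw [dif_pos ht', dif_pos ⟨hj, ht'⟩]
    rfl

theorem measurable_samplePsi (ν : ℝ) (α : ℕ → ℝ) (β : ℕ → Fin K → ℝ) (N T : ℕ) (i : Fin N) :
    Measurable fun s => samplePsi ν α β N T s i := by
  have hf : ∀ (t : ℤ) (k : Fin K), Measurable fun s : (Fin N → Set.Icc (1 : ℤ) (T : ℤ) → ℝ) ×
      (Set.Icc (1 : ℤ) (T : ℤ) → EuclideanSpace ℝ (Fin K)) =>
      (if h : t ∈ Set.Icc (1 : ℤ) T then s.2 ⟨t, h⟩ else 0 : EuclideanSpace ℝ (Fin K)) k := by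
    intro t k
    split_ifs with h
    · exact (measurable_pi_apply k).comp ((WithLp.measurable_ofLp 2 _).comp
        ((measurable_pi_apply _).comp measurable_snd))
    · exact measurable_const
  have hu : ∀ (i : ℕ) (t : ℤ), Measurable fun s : (Fin N → Set.Icc (1 : ℤ) (T : ℤ) → ℝ) ×
      (Set.Icc (1 : ℤ) (T : ℤ) → EuclideanSpace ℝ (Fin K)) =>
      (if h : i < N ∧ t ∈ Set.Icc (1 : ℤ) T then s.1 ⟨i, h.1⟩ ⟨t, h.2⟩ else 0 : ℝ) := by
    intro i t
    split_ifs with h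
    · exact (measurable_pi_apply _).comp ((measurable_pi_apply _).comp measurable_fst)
    · exact measurable_const
  refine measurable_psiStat ν N T hf (fun i t => ?_) i
  exact (measurable_const.add (Finset.measurable_fun_sum _ fun k _ =>
    (hf t k).const_mul _)).add (hu i t)

/-- The conditional distribution function of the normalised statistic, for all sample sizes for
which the scaling is positive. -/
theorem ae_condCDFStat_eq [IsProbabilityMeasure P] (ν : ℝ) (α : ℕ → ℝ) (β : ℕ → Fin K → ℝ)
    {f : ℤ → Ω → EuclideanSpace ℝ (Fin K)} {u : ℕ → ℤ → Ω → ℝ} (hf : ∀ t, Measurable (f t))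
    (hu : ∀ i t, Measurable (u i t)) {w : ℕ → Ω → ℝ}
    (hw_meas : ∀ i, Measurable (w i)) (hw_indep : iIndepFun w P)
    (hw_law : ∀ i, P.map (w i) = gaussianReal 0 1)
    (hw_sample : ∀ N T : ℕ,
      IndepFun (fun ω (i : Fin N) => w i ω) (sampleNT f u N T) P) :
    ∀ᵐ ω ∂P, ∀ N T : ℕ, 1 ≤ N → 0 < gumbelA N → ∀ x : ℝ,
      condCDFStat P ν α β f u w N T x ω = ∏ i : Fin N, (gaussianReal 0 1).real
        (Set.Iic (gumbelB N + gumbelA N * x - psiStat ν N T (fun t => f t ω)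
          (returns α β (fun t => f t ω) fun i t => u i t ω) i)) := by
  rw [ae_all_iff]; intro N
  rw [ae_all_iff]; intro T
  by_cases hN : 1 ≤ N
  swap; · exact ae_of_all _ fun ω h => absurd h hN
  by_cases ha : 0 < gumbelA N
  swap; · exact ae_of_all _ fun ω _ h => absurd h ha
  have hX : Measurable (sampleNT f u N T) := by
    unfold sampleNT
    exact Measurable.prodMk
      (measurable_pi_iff.2 fun i : Fin N => measurable_pi_iff.2 fun t => hu i t)
      (measurable_pi_iff.2 fun t : Set.Icc (1 : ℤ) T => hf t)
  have key := condDistrib_normalizedMax hN hX hw_meas hw_indep hw_law (hw_sample N T)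
    (measurable_samplePsi ν α β N T) ha (gumbelB N)
  filter_upwards [key] with ω hω _ _ x
  have h := hω x
  simp only [samplePsi_sampleNT] at h
  exact h

end ConditionalLaw

/-! ### Almost sure behaviour of the estimators -/

section Paths

variable {Ω : Type*} [MeasurableSpace Ω] {P : Measure Ω} [IsProbabilityMeasure P] {K : ℕ}

theorem tendsto_natCast_rpow_neg {δ : ℝ} (hδ : 0 < δ) :
    Tendsto (fun T : ℕ => (T : ℝ) ^ (-δ)) atTop (𝓝 0) :=
  (tendsto_rpow_neg_atTop hδ).comp tendsto_natCast_atTop_atTop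

/-- Law of large numbers for decomposable shifts. -/
theorem IsDecomposableShift.ae_tendsto_timeMean {S : Type*} [MeasurableSpace S]
    {η : ℤ → Ω → S} {x : ℤ → Ω → ℝ} {p a c : ℝ} (hp : 2 < p) (ha : 1 < a)
    (hx : IsDecomposableShift P η x p a c) :
    ∀ᵐ ω ∂P, Tendsto (fun T => timeMean T (fun t => x t ω)) atTop (𝓝 (∫ ω, x 0 ω ∂P)) := by
  have hb : ∀ t, eLpNorm (x t) (ENNReal.ofReal p) P ≤
      ENNReal.ofReal (eLpNorm (x 0) (ENNReal.ofReal p) P).toReal := by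
    intro t
    rw [ENNReal.ofReal_toReal (hx.memLp 0).2.ne, (hx.identDistrib t).eLpNorm_eq]
  have key := ae_exists_abs_timeMean_sub_le (P := P) (S := fun _ => S) (η := fun _ => η)
    (x := fun _ => x) hp ha ENNReal.toReal_nonneg (fun _ => hx) (fun _ => hb) 1 (θ := 0)
    (δ := 1 / 4) (by linarith)
  filter_upwards [key] with ω ⟨R, hR, h⟩
  rw [tendsto_iff_norm_sub_tendsto_zero]
  have hlim := (tendsto_natCast_rpow_neg (δ := 1 / 4) (by norm_num)).const_mul R
  rw [mul_zero] at hlim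
  refine squeeze_zero' (Eventually.of_forall fun T => norm_nonneg _) ?_ hlim
  filter_upwards [eventually_ge_atTop 1] with T hT
  exact h T hT 0 (by simp)

/-- For almost every path the sample covariance matrix of the factors is eventually invertible, and
all the factor moments that enter the estimators stay bounded. -/
theorem ae_exists_factor_bounds {S : Type*} [MeasurableSpace S] {η : ℤ → Ω → S}
    {f : ℤ → Ω → EuclideanSpace ℝ (Fin K)} {ν a c : ℝ} (hν : 4 < ν) (ha : 1 < a)
    (hf : IsDecomposableShift P η f ν a c) (hV : (covMatrix P (f 0)).PosDef) :
    ∀ᵐ ω ∂P, ∃ L, 0 ≤ L ∧ ∀ᶠ T : ℕ in atTop, (sampleCov T (fun t => f t ω)).det ≠ 0 ∧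
      (∀ k l, |(sampleCov T (fun t => f t ω))⁻¹ k l| ≤ L) ∧
      (∀ k, |factorMean T (fun t => f t ω) k| ≤ L) ∧
      (∀ k, timeMean T (fun t => f t ω k ^ 2) ≤ L) := by
  have hbf : ∀ k t, eLpNorm (fun ω => f t ω k) (ENNReal.ofReal ν) P ≤
      ENNReal.ofReal (eLpNorm (f 0) (ENNReal.ofReal ν) P).toReal := by
    intro k t
    rw [ENNReal.ofReal_toReal (hf.memLp 0).2.ne, ← (hf.identDistrib t).eLpNorm_eq]
    exact eLpNorm_mono fun ω => PiLp.norm_apply_le (f t ω) k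
  have hprod : ∀ k l, IsDecomposableShift P η (fun t ω => f t ω k * f t ω l) (ν / 2) (min a a)
      _ := fun k l => (hf.coord k).mul (by linarith) (hf.coord l) ENNReal.toReal_nonneg
        ENNReal.toReal_nonneg (hbf k) (hbf l)
  have h1 : ∀ᵐ ω ∂P, ∀ k, Tendsto (fun T => timeMean T (fun t => f t ω k)) atTop
      (𝓝 (∫ ω, f 0 ω k ∂P)) :=
    ae_all_iff.2 fun k => (hf.coord k).ae_tendsto_timeMean (by linarith) ha
  have h2 : ∀ᵐ ω ∂P, ∀ k l, Tendsto (fun T => timeMean T (fun t => f t ω k * f t ω l)) atTop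
      (𝓝 (∫ ω, f 0 ω k * f 0 ω l ∂P)) :=
    ae_all_iff.2 fun k => ae_all_iff.2 fun l =>
      (hprod k l).ae_tendsto_timeMean (by linarith) (by simpa using ha)
  filter_upwards [h1, h2] with ω hω1 hω2
  set V := covMatrix P (f 0) with hVdef
  have hcov : Tendsto (fun T => sampleCov T (fun t => f t ω)) atTop (𝓝 V) := by
    refine tendsto_pi_nhds.2 fun k => tendsto_pi_nhds.2 fun l => ?_
    have h := (hω2 k l).sub ((hω1 k).mul (hω1 l))
    have hmem : ∀ k, MemLp (fun ω => f 0 ω k) 2 P := fun k =>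
      ((hf.coord k).memLp 0).mono_exponent (by
        rw [show (2 : ℝ≥0∞) = ENNReal.ofReal 2 by simp]
        exact ENNReal.ofReal_le_ofReal (by linarith))
    have hval : V k l = (∫ ω, f 0 ω k * f 0 ω l ∂P) -
        (∫ ω, f 0 ω k ∂P) * ∫ ω, f 0 ω l ∂P := by
      rw [hVdef, covMatrix, Matrix.of_apply, covariance_eq_sub (hmem k) (hmem l)]
      rfl
    rw [hval]
    exact h
  have hdetV : V.det ≠ 0 := hV.det_pos.ne'
  have hdet : Tendsto (fun T => (sampleCov T (fun t => f t ω)).det) atTop (𝓝 V.det) :=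
    ((continuous_id.matrix_det).tendsto V).comp hcov
  have hinv : Tendsto (fun T => (sampleCov T (fun t => f t ω))⁻¹) atTop (𝓝 V⁻¹) := by
    simp only [Matrix.inv_def, Ring.inverse_eq_inv']
    exact (hdet.inv₀ hdetV).smul (((continuous_id.matrix_adjugate).tendsto V).comp hcov)
  have hinv' : ∀ k l, Tendsto (fun T => (sampleCov T (fun t => f t ω))⁻¹ k l) atTop
      (𝓝 (V⁻¹ k l)) := fun k l => tendsto_pi_nhds.1 (tendsto_pi_nhds.1 hinv k) l
  -- one constant that exceeds all the (finitely many) limits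
  set L : ℝ := (∑ k, ∑ l, |V⁻¹ k l|) + (∑ k, |∫ ω, f 0 ω k ∂P|) +
    (∑ k, |∫ ω, f 0 ω k * f 0 ω k ∂P|) + 1 with hL
  have s1 : 0 ≤ ∑ k, ∑ l, |V⁻¹ k l| :=
    Finset.sum_nonneg fun k _ => Finset.sum_nonneg fun l _ => abs_nonneg _
  have s2 : 0 ≤ ∑ k, |∫ ω, f 0 ω k ∂P| := Finset.sum_nonneg fun k _ => abs_nonneg _
  have s3 : 0 ≤ ∑ k, |∫ ω, f 0 ω k * f 0 ω k ∂P| := Finset.sum_nonneg fun k _ => abs_nonneg _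
  refine ⟨L, by positivity, ?_⟩
  refine (hdet.eventually_ne hdetV).and (Filter.Eventually.and ?_ (Filter.Eventually.and ?_ ?_))
  · refine eventually_all.2 fun k => eventually_all.2 fun l => ?_
    refine ((hinv' k l).abs.eventually_lt_const (u := L) ?_).mono fun T h => h.le
    have e1 : |V⁻¹ k l| ≤ ∑ l, |V⁻¹ k l| :=
      Finset.single_le_sum (f := fun l => |V⁻¹ k l|) (fun _ _ => abs_nonneg _) (Finset.mem_univ l)
    have e2 : ∑ l, |V⁻¹ k l| ≤ ∑ k, ∑ l, |V⁻¹ k l| :=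
      Finset.single_le_sum (f := fun k => ∑ l, |V⁻¹ k l|)
        (fun _ _ => Finset.sum_nonneg fun _ _ => abs_nonneg _) (Finset.mem_univ k)
    linarith
  · refine eventually_all.2 fun k => ?_
    refine ((hω1 k).abs.eventually_lt_const (u := L) ?_).mono fun T h => h.le
    have e1 : |∫ ω, f 0 ω k ∂P| ≤ ∑ k, |∫ ω, f 0 ω k ∂P| :=
      Finset.single_le_sum (f := fun k => |∫ ω, f 0 ω k ∂P|) (fun _ _ => abs_nonneg _)
        (Finset.mem_univ k)
    linarith
  · refine eventually_all.2 fun k => ?_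
    simp only [pow_two]
    refine ((hω2 k k).eventually_lt_const (u := L) ?_).mono fun T h => h.le
    have e1 : |∫ ω, f 0 ω k * f 0 ω k ∂P| ≤ ∑ k, |∫ ω, f 0 ω k * f 0 ω k ∂P| :=
      Finset.single_le_sum (f := fun k => |∫ ω, f 0 ω k * f 0 ω k ∂P|) (fun _ _ => abs_nonneg _)
        (Finset.mem_univ k)
    have e2 := le_abs_self (∫ ω, f 0 ω k * f 0 ω k ∂P)
    linarith

theorem integral_mul_coord_eq_zero {f : Ω → EuclideanSpace ℝ (Fin K)} {u : Ω → ℝ} {ν : ℝ}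
    (hν : 4 < ν) (hf : MemLp f (ENNReal.ofReal ν) P) (hu : MemLp u (ENNReal.ofReal ν) P)
    (h : ∫ ω, u ω • f ω ∂P = 0) (k : Fin K) : ∫ ω, f ω k * u ω ∂P = 0 := by
  have h2 : (2 : ℝ≥0∞) ≤ ENNReal.ofReal ν := by
    rw [show (2 : ℝ≥0∞) = ENNReal.ofReal 2 by simp]
    exact ENNReal.ofReal_le_ofReal (by linarith)
  have hint : Integrable (fun ω => u ω • f ω) P :=
    memLp_one_iff_integrable.1 ((hf.mono_exponent h2).smul (r := 1) (hu.mono_exponent h2))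
  have := (EuclideanSpace.proj (𝕜 := ℝ) k).integral_comp_comm hint
  rw [h, map_zero] at this
  rw [← this]
  refine integral_congr_ae (ae_of_all _ fun ω => ?_)
  simp [mul_comm]

/-- Almost surely, for all units in the admissible range at once, the estimation error of alpha is
of order `T ^ (-δ)`, `δ = (1 + ε) / ν`, and the rescaling sequence is bounded and bounded away
from zero. -/
theorem ae_exists_estimator_bounds
    {ν : ℝ} (hν : 4 < ν) (α : ℕ → ℝ) (β : ℕ → Fin K → ℝ)
    {f : ℤ → Ω → EuclideanSpace ℝ (Fin K)} {u : ℕ → ℤ → Ω → ℝ}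
    {Sf : Type*} [MeasurableSpace Sf] {ηf : ℤ → Ω → Sf}
    {Su : ℕ → Type*} [∀ i, MeasurableSpace (Su i)] {ηu : (i : ℕ) → ℤ → Ω → Su i}
    {au cu : ℝ} (hau : 1 < au) (hu : ∀ i, IsDecomposableShift P (ηu i) (u i) ν au cu)
    {M : ℝ≥0} (huM : ∀ i t, eLpNorm (u i t) (ENNReal.ofReal ν) P ≤ M)
    (hu0 : ∀ i t, ∫ ω, u i t ω ∂P = 0)
    {σ : ℝ} (hσ : 0 < σ) (huσ : ∀ i t, σ ≤ ∫ ω, u i t ω ^ 2 ∂P)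
    {af cf : ℝ} (haf : 1 < af) (hf : IsDecomposableShift P ηf f ν af cf)
    (hfV : ∀ t, (covMatrix P (f t)).PosDef)
    (hjoint : ∀ i, IsIIDSeq P (fun t ω => (ηf t ω, ηu i t ω)))
    (hexo : ∀ i t, ∫ ω, u i t ω • f t ω ∂P = 0)
    {ε : ℝ} (hε : 0 < ε) (C : ℝ) :
    ∀ᵐ ω ∂P, ∃ B s, 0 ≤ B ∧ 0 < s ∧ ∀ᶠ T : ℕ in atTop, ∀ N : ℕ, 1 ≤ N →
      (N : ℝ) ≤ C * (T : ℝ) ^ ((1 / 2 : ℝ) * (ν / 2 - 1) - ε) →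
      (∀ i < N, |alphaHat T (fun t => f t ω)
          (returns α β (fun t => f t ω) (fun i t => u i t ω) i) - α i| ≤
          B * (T : ℝ) ^ (-((1 + ε) / ν))) ∧
        sHat N T (fun t => f t ω) (returns α β (fun t => f t ω) (fun i t => u i t ω)) ∈
          Set.Icc s B := by
  set θ : ℝ := (1 / 2 : ℝ) * (ν / 2 - 1) - ε with hθ
  set δ : ℝ := (1 + ε) / ν with hδ
  have hδ0 : 0 < δ := by positivity
  have hθδ : θ + ν / 2 * δ < ν / 2 / 2 := by
    have : ν / 2 * δ = (1 + ε) / 2 := by rw [hδ]; field_simp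
    rw [this, hθ]; linarith
  have hp : 2 < ν / 2 := by linarith
  have hM0 : (0 : ℝ) ≤ M := M.coe_nonneg
  set bf : ℝ := (eLpNorm (f 0) (ENNReal.ofReal ν) P).toReal with hbf
  have hbf0 : 0 ≤ bf := ENNReal.toReal_nonneg
  have hfb : ∀ k t, eLpNorm (fun ω => f t ω k) (ENNReal.ofReal ν) P ≤ ENNReal.ofReal bf := by
    intro k t
    rw [hbf, ENNReal.ofReal_toReal (hf.memLp 0).2.ne, ← (hf.identDistrib t).eLpNorm_eq]
    exact eLpNorm_mono fun ω => PiLp.norm_apply_le (f t ω) k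
  have huM' : ∀ i t, eLpNorm (u i t) (ENNReal.ofReal ν) P ≤ ENNReal.ofReal M := by
    intro i t; simpa using huM i t
  -- both processes as shifts of the joint innovations
  have hu' : ∀ i, IsDecomposableShift P (fun t ω => (ηf t ω, ηu i t ω)) (u i) ν au cu :=
    fun i => IsDecomposableShift.of_factor (hjoint i) measurable_snd (hu i)
  have hf' : ∀ i k, IsDecomposableShift P (fun t ω => (ηf t ω, ηu i t ω))
      (fun t ω => f t ω k) ν af cf :=
    fun i k => IsDecomposableShift.of_factor (hjoint i) measurable_fst (hf.coord k)
  have hfu : ∀ k i, IsDecomposableShift P (fun t ω => (ηf t ω, ηu i t ω))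
      (fun t ω => f t ω k * u i t ω) (ν / 2) (min af au) _ := fun k i =>
    (hf' i k).mul (by linarith) (hu' i) hbf0 hM0 (hfb k) (huM' i)
  have huu : ∀ i, IsDecomposableShift P (ηu i)
      (fun t ω => u i t ω * u i t ω) (ν / 2) (min au au) _ := fun i =>
    (hu i).mul (by linarith) (hu i) hM0 hM0 (huM' i) (huM' i)
  have hfub : ∀ k i t, eLpNorm (fun ω => f t ω k * u i t ω) (ENNReal.ofReal (ν / 2)) P ≤
      ENNReal.ofReal (bf * M) := by
    intro k i t
    rw [ENNReal.ofReal_mul hbf0]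
    exact (eLpNorm_mul_le_half (by linarith) ((hf.coord k).measurable t)
      ((hu i).measurable t)).trans (mul_le_mul' (hfb k t) (huM' i t))
  have huub : ∀ i t, eLpNorm (fun ω => u i t ω * u i t ω) (ENNReal.ofReal (ν / 2)) P ≤
      ENNReal.ofReal (M * M) := by
    intro i t
    rw [ENNReal.ofReal_mul hM0]
    exact (eLpNorm_mul_le_half (by linarith) ((hu i).measurable t)
      ((hu i).measurable t)).trans (mul_le_mul' (huM' i t) (huM' i t))
  have hub : ∀ i t, eLpNorm (u i t) (ENNReal.ofReal (ν / 2)) P ≤ ENNReal.ofReal M := fun i t =>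
    (eLpNorm_le_eLpNorm_of_exponent_le (ENNReal.ofReal_le_ofReal (by linarith))
      ((hu i).measurable t).aestronglyMeasurable).trans (huM' i t)
  have r1 := ae_exists_abs_timeMean_sub_le (P := P) hp hau hM0
    (fun i => (hu i).mono_exponent (q := ν / 2) (by linarith)) hub C hθδ
  have r2 : ∀ᵐ ω ∂P, ∀ k, ∃ R, 0 ≤ R ∧ ∀ T : ℕ, 1 ≤ T → ∀ i : ℕ, (i : ℝ) + 1 ≤ C * (T : ℝ) ^ θ →
      |timeMean T (fun t => f t ω k * u i t ω) - ∫ ω, f 0 ω k * u i 0 ω ∂P| ≤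
        R * (T : ℝ) ^ (-δ) :=
    ae_all_iff.2 fun k => ae_exists_abs_timeMean_sub_le (P := P) hp (lt_min haf hau)
      (mul_nonneg hbf0 hM0) (hfu k) (hfub k) C hθδ
  have r3 := ae_exists_abs_timeMean_sub_le (P := P) hp (lt_min hau hau)
    (mul_nonneg hM0 hM0) huu huub C hθδ
  have hEfu : ∀ k i, ∫ ω, f 0 ω k * u i 0 ω ∂P = 0 := fun k i =>
    integral_mul_coord_eq_zero hν (hf.memLp 0) ((hu i).memLp 0) (hexo i 0) k
  have hEuu : ∀ i, ∫ ω, u i 0 ω * u i 0 ω ∂P ≤ M * M := by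
    intro i
    have h1 : ‖∫ ω, u i 0 ω * u i 0 ω ∂P‖ₑ ≤ ENNReal.ofReal (M * M) := by
      refine (enorm_integral_le_lintegral_enorm _).trans ?_
      rw [← eLpNorm_one_eq_lintegral_enorm]
      exact (eLpNorm_le_eLpNorm_of_exponent_le (by rw [ENNReal.one_le_ofReal]; linarith)
        ((huu i).measurable 0).aestronglyMeasurable).trans (huub i 0)
    rw [Real.enorm_eq_ofReal_abs, ENNReal.ofReal_le_ofReal_iff (mul_nonneg hM0 hM0)] at h1
    exact (le_abs_self _).trans h1
  filter_upwards [r1, r2, r3, ae_exists_factor_bounds hν haf hf (hfV 0)] with ω ⟨R₁, hR₁, h1⟩ hr2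
    ⟨R₃, hR₃, h3⟩ ⟨L, hL, hfac⟩
  choose R₂ hR₂ h2 using hr2
  simp only [hu0, hEfu, sub_zero] at h1 h2
  obtain ⟨B, hB, hols⟩ := exists_leastSquares_bounds K hL
  set R : ℝ := R₁ + ∑ k, R₂ k with hR
  have hR₂s : 0 ≤ ∑ k, R₂ k := Finset.sum_nonneg fun k _ => hR₂ k
  have hR0 : 0 ≤ R := by positivity
  have hT := tendsto_natCast_rpow_neg hδ0
  have hTB : Tendsto (fun T : ℕ => B * (R * (T : ℝ) ^ (-δ)) ^ 2) atTop (𝓝 0) := by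
    simpa using ((hT.const_mul R).pow 2).const_mul B
  have hT3 : Tendsto (fun T : ℕ => R₃ * (T : ℝ) ^ (-δ)) atTop (𝓝 0) := by
    simpa using hT.const_mul R₃
  refine ⟨max (B * R) √(2 * (M * M + 1) + 1), √(σ / 2), le_max_of_le_right (Real.sqrt_nonneg _),
    Real.sqrt_pos.2 (by positivity), ?_⟩
  filter_upwards [hfac, eventually_ge_atTop 1,
    hTB.eventually_lt_const (show (0 : ℝ) < min (σ / 4) 1 by positivity),
    hT3.eventually_lt_const (show (0 : ℝ) < min (σ / 4) 1 by positivity)] with T hTfac hT1 hTB hT3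
  intro N hN hNT
  obtain ⟨hdet, hinv, hmean, hsq⟩ := hTfac
  have hpow0 : 0 ≤ (T : ℝ) ^ (-δ) := by positivity
  have hi : ∀ i < N, (i : ℝ) + 1 ≤ C * (T : ℝ) ^ θ := by
    intro i hi
    refine le_trans ?_ hNT
    exact_mod_cast hi
  have hunit := fun i (hiN : i < N) => hols T hT1 (fun t => f t ω) α β (fun i t => u i t ω) i
    (R * (T : ℝ) ^ (-δ)) (by positivity) hdet hinv hmean hsq
    ((h1 T hT1 i (hi i hiN)).trans (by gcongr; linarith))
    (fun k => (h2 k T hT1 i (hi i hiN)).trans (by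
      gcongr
      have := Finset.single_le_sum (f := R₂) (fun k _ => hR₂ k) (Finset.mem_univ k)
      linarith))
  have hB1 := hTB.trans_le (min_le_left _ _)
  have hB2 := hTB.trans_le (min_le_right _ _)
  have h31 := hT3.trans_le (min_le_left _ _)
  have h32 := hT3.trans_le (min_le_right _ _)
  refine ⟨fun i hiN => (hunit i hiN).1.trans ?_, ?_⟩
  · rw [← mul_assoc]
    gcongr
    exact le_max_left _ _
  · have havg := avg_mem_Icc hN (z := fun i => timeMean T (fun t => olsResidual T (fun t => f t ω)
        (returns α β (fun t => f t ω) (fun i t => u i t ω) i) t ^ 2)) (lo := σ / 2)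
        (hi := 2 * (M * M + 1) + 1) (fun i hiN => by
      obtain ⟨-, hlo, hhi⟩ := hunit i hiN
      have hdev := abs_le.1 (h3 T hT1 i (hi i hiN))
      have hσi := huσ i 0
      have hMi := hEuu i
      simp only [← pow_two] at hdev hMi
      constructor <;> linarith)
    rw [sHat_eq]
    exact ⟨Real.sqrt_le_sqrt havg.1, (Real.sqrt_le_sqrt havg.2).trans (le_max_right _ _)⟩

end Paths

/-! ### Limits of the conditional distribution function -/

section Limits

theorem jointLimit_le_prod (ν ε C : ℝ) : jointLimit ν ε C ≤ atTop ×ˢ atTop := inf_le_left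

theorem tendsto_fst_jointLimit (ν ε C : ℝ) :
    Tendsto (fun p : ℕ × ℕ => p.1) (jointLimit ν ε C) atTop :=
  tendsto_fst.mono_left (jointLimit_le_prod ν ε C)

theorem tendsto_snd_jointLimit (ν ε C : ℝ) :
    Tendsto (fun p : ℕ × ℕ => p.2) (jointLimit ν ε C) atTop :=
  tendsto_snd.mono_left (jointLimit_le_prod ν ε C)

theorem eventually_le_jointLimit (ν ε C : ℝ) : ∀ᶠ p : ℕ × ℕ in jointLimit ν ε C,
    (p.1 : ℝ) ≤ C * (p.2 : ℝ) ^ ((1 / 2 : ℝ) * (ν / 2 - 1) - ε) :=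
  mem_inf_of_right (mem_principal_self _)

/-- In the admissible range `N` grows at most polynomially in `T`, so `log N` is negligible
against every power of `T`. -/
theorem tendsto_sqrt_log_mul_rpow_neg (ν ε C : ℝ) {r : ℝ} (hr : 0 < r) :
    Tendsto (fun p : ℕ × ℕ => √(2 * Real.log p.1) * (p.2 : ℝ) ^ (-r)) (jointLimit ν ε C)
      (𝓝 0) := by
  set θ : ℝ := (1 / 2 : ℝ) * (ν / 2 - 1) - ε with hθ
  have hlog : Tendsto (fun T : ℕ => Real.log T * (T : ℝ) ^ (-(2 * r))) atTop (𝓝 0) := by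
    have h := ((isLittleO_log_rpow_atTop (r := 2 * r) (by positivity)).tendsto_div_nhds_zero).comp
      tendsto_natCast_atTop_atTop
    refine h.congr fun T => ?_
    simp only [Function.comp]
    rw [Real.rpow_neg (Nat.cast_nonneg T), div_eq_mul_inv]
  have hpow := tendsto_natCast_rpow_neg (δ := 2 * r) (by positivity)
  have hbound : Tendsto (fun T : ℕ => √(2 * (|Real.log C| * (T : ℝ) ^ (-(2 * r)) +
      |θ| * (Real.log T * (T : ℝ) ^ (-(2 * r)))))) atTop (𝓝 0) := by
    have h := ((hpow.const_mul |Real.log C|).add (hlog.const_mul |θ|)).const_mul 2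
    simp only [mul_zero, add_zero] at h
    have h' := (Real.continuous_sqrt.tendsto 0).comp h
    rwa [Real.sqrt_zero] at h'
  refine squeeze_zero' (Eventually.of_forall fun p => by positivity) ?_
    (hbound.comp (tendsto_snd_jointLimit ν ε C))
  filter_upwards [eventually_le_jointLimit ν ε C,
    (tendsto_fst_jointLimit ν ε C).eventually_ge_atTop 1,
    (tendsto_snd_jointLimit ν ε C).eventually_ge_atTop 1] with p hp hN hT
  have hT0 : (0 : ℝ) < p.2 := by exact_mod_cast hT
  have hT1 : (1 : ℝ) ≤ p.2 := by exact_mod_cast hT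
  have hN0 : (0 : ℝ) < p.1 := by exact_mod_cast hN
  have hC : 0 < C := by
    by_contra h
    have : C * (p.2 : ℝ) ^ θ ≤ 0 := mul_nonpos_of_nonpos_of_nonneg (not_lt.1 h) (by positivity)
    linarith
  have hlogN : Real.log p.1 ≤ |Real.log C| + |θ| * Real.log p.2 := by
    refine (Real.log_le_log hN0 hp).trans ?_
    rw [Real.log_mul hC.ne' (by positivity), Real.log_rpow hT0]
    refine add_le_add (le_abs_self _) ?_
    exact mul_le_mul_of_nonneg_right (le_abs_self _) (Real.log_nonneg hT1)
  have hsplit : (p.2 : ℝ) ^ (-r) = √((p.2 : ℝ) ^ (-(2 * r))) := by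
    rw [Real.sqrt_eq_rpow, ← Real.rpow_mul hT0.le]
    congr 1; ring
  simp only [Function.comp]
  rw [hsplit, ← Real.sqrt_mul' _ (by positivity)]
  refine Real.sqrt_le_sqrt ?_
  have h0 : 0 ≤ (p.2 : ℝ) ^ (-(2 * r)) := by positivity
  calc 2 * Real.log p.1 * (p.2 : ℝ) ^ (-(2 * r))
      ≤ 2 * (|Real.log C| + |θ| * Real.log p.2) * (p.2 : ℝ) ^ (-(2 * r)) := by gcongr
    _ = _ := by ring

theorem rpow_mul_rpow_half {ν : ℝ} (hν : 4 < ν) {T : ℕ} (hT : 1 ≤ T) {c r : ℝ} (hc : 0 ≤ c) :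
    ((T : ℝ) ^ (1 / ν) * (c * (T : ℝ) ^ (-r))) ^ (ν / 2) =
      c ^ (ν / 2) * (T : ℝ) ^ (1 / 2 - ν / 2 * r) := by
  have hT0 : (0 : ℝ) < T := by exact_mod_cast hT
  rw [show (T : ℝ) ^ (1 / ν) * (c * (T : ℝ) ^ (-r)) = c * ((T : ℝ) ^ (1 / ν) * (T : ℝ) ^ (-r)) by
    ring, ← Real.rpow_add hT0, Real.mul_rpow hc (by positivity), ← Real.rpow_mul hT0.le]
  congr 2
  field_simp
  ring

theorem psiStat_nonneg {K : ℕ} (ν : ℝ) (N T : ℕ) (f : ℤ → EuclideanSpace ℝ (Fin K))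
    (y : ℕ → ℤ → ℝ) (i : ℕ) : 0 ≤ psiStat ν N T f y i := by
  unfold psiStat; positivity

theorem psiStat_le {K : ℕ} {ν : ℝ} (hν : 4 < ν) {N T : ℕ} (hT : 1 ≤ T)
    {f : ℤ → EuclideanSpace ℝ (Fin K)} {y : ℕ → ℤ → ℝ} {i : ℕ} {ε B s : ℝ} (hB : 0 ≤ B)
    (hs : 0 < s) (halpha : |alphaHat T f (y i)| ≤ B * (T : ℝ) ^ (-((1 + ε) / ν)))
    (hsHat : s ≤ sHat N T f y) :
    psiStat ν N T f y i ≤ (B / s) ^ (ν / 2) * (T : ℝ) ^ (-(ε / 2)) := by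
  have hT0 : (0 : ℝ) < T := by exact_mod_cast hT
  have h1 : |(T : ℝ) ^ (1 / ν) * alphaHat T f (y i) / sHat N T f y| ≤
      (T : ℝ) ^ (1 / ν) * (B / s * (T : ℝ) ^ (-((1 + ε) / ν))) := by
    rw [abs_div, abs_mul, abs_of_pos (by positivity : 0 < (T : ℝ) ^ (1 / ν)),
      abs_of_pos (hs.trans_le hsHat)]
    calc (T : ℝ) ^ (1 / ν) * |alphaHat T f (y i)| / sHat N T f y
        ≤ (T : ℝ) ^ (1 / ν) * (B * (T : ℝ) ^ (-((1 + ε) / ν))) / s := by gcongr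
      _ = _ := by ring
  refine (Real.rpow_le_rpow (abs_nonneg _) h1 (by positivity)).trans (le_of_eq ?_)
  rw [rpow_mul_rpow_half hν hT (by positivity)]
  congr 2
  field_simp
  ring

theorem le_psiStat {K : ℕ} {ν : ℝ} (hν : 4 < ν) {N T : ℕ} (hT : 1 ≤ T)
    {f : ℤ → EuclideanSpace ℝ (Fin K)} {y : ℕ → ℤ → ℝ} {i : ℕ} {κ B : ℝ} (hκ : 0 ≤ κ)
    (halpha : κ ≤ |alphaHat T f (y i)|) (hs : 0 < sHat N T f y) (hsB : sHat N T f y ≤ B) :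
    (κ / B) ^ (ν / 2) * (T : ℝ) ^ (1 / 2 : ℝ) ≤ psiStat ν N T f y i := by
  have hT0 : (0 : ℝ) < T := by exact_mod_cast hT
  have hB : 0 < B := hs.trans_le hsB
  have h1 : (T : ℝ) ^ (1 / ν) * (κ / B * (T : ℝ) ^ (-(0 : ℝ))) ≤
      |(T : ℝ) ^ (1 / ν) * alphaHat T f (y i) / sHat N T f y| := by
    rw [abs_div, abs_mul, abs_of_pos (by positivity : 0 < (T : ℝ) ^ (1 / ν)), abs_of_pos hs,
      neg_zero, Real.rpow_zero, mul_one, ← mul_div_assoc]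
    gcongr
  refine le_trans (le_of_eq ?_) (Real.rpow_le_rpow (by positivity) h1 (by positivity))
  rw [rpow_mul_rpow_half hν hT (by positivity)]
  congr 2
  ring

theorem normalCDF_mono {x y : ℝ} (h : x ≤ y) :
    (gaussianReal 0 1).real (Set.Iic x) ≤ (gaussianReal 0 1).real (Set.Iic y) :=
  measureReal_mono (Set.Iic_subset_Iic.2 h)

theorem tendsto_gumbelA_mul_sqrt :
    Tendsto (fun n : ℕ => gumbelA n * √(2 * Real.log n)) atTop (𝓝 1) := by
  have h := tendsto_gumbelA_mul_gumbelB.div tendsto_gumbelB_div_sqrt one_ne_zero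
  rw [div_one] at h
  refine h.congr' ?_
  filter_upwards [tendsto_gumbelB.eventually_gt_atTop 0,
    tendsto_sqrt_two_log.eventually_gt_atTop 0] with n hb hs
  simp only [Pi.div_apply]
  field_simp

theorem eventually_gumbelA_pos : ∀ᶠ n : ℕ in atTop, 0 < gumbelA n := by
  filter_upwards [tendsto_gumbelB.eventually_gt_atTop 0] with n hb
  unfold gumbelA
  positivity

/-- If the shifts are nonnegative and negligible against the scaling, the maximum has the same
limit law as without them. -/
theorem tendsto_prod_normalCDF_of_shift_small {l : Filter (ℕ × ℕ)}
    (hl : Tendsto (fun p : ℕ × ℕ => p.1) l atTop) {ψ : ℕ × ℕ → ℕ → ℝ} (hψ0 : ∀ p i, 0 ≤ ψ p i)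
    (hψ : ∀ ρ > 0, ∀ᶠ p in l, ∀ i < p.1, ψ p i ≤ ρ * gumbelA p.1) (x : ℝ) :
    Tendsto (fun p : ℕ × ℕ => ∏ i : Fin p.1, (gaussianReal 0 1).real
      (Set.Iic (gumbelB p.1 + gumbelA p.1 * x - ψ p i))) l (𝓝 (Real.exp (-Real.exp (-x)))) := by
  rw [tendsto_order]
  constructor
  · intro y hy
    -- the limit law is continuous, so a small shift of `x` can be afforded
    have hcont : Tendsto (fun ρ : ℝ => Real.exp (-Real.exp (-(x - ρ)))) (𝓝[>] 0)
        (𝓝 (Real.exp (-Real.exp (-x)))) := by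
      have : Continuous fun ρ : ℝ => Real.exp (-Real.exp (-(x - ρ))) := by fun_prop
      have h := this.tendsto 0
      rw [sub_zero] at h
      exact h.mono_left nhdsWithin_le_nhds
    obtain ⟨ρ, hρy, hρ⟩ := ((hcont.eventually_const_lt hy).and self_mem_nhdsWithin).exists
    filter_upwards [hψ ρ hρ, ((tendsto_normalCDF_pow (x - ρ)).comp hl).eventually_const_lt hρy]
      with p hp hlow
    refine hlow.trans_le ?_
    simp only [Function.comp]
    rw [← Fin.prod_const]
    refine Finset.prod_le_prod (fun i _ => measureReal_nonneg) fun i _ => normalCDF_mono ?_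
    have := hp i i.2
    nlinarith
  · intro y hy
    filter_upwards [((tendsto_normalCDF_pow x).comp hl).eventually_lt_const hy] with p hup
    refine lt_of_le_of_lt ?_ hup
    simp only [Function.comp]
    rw [← Fin.prod_const]
    refine Finset.prod_le_prod (fun i _ => measureReal_nonneg) fun i _ => normalCDF_mono ?_
    linarith [hψ0 p i]

/-- A single shift that dominates the centring drives the distribution function to zero. -/
theorem tendsto_prod_normalCDF_of_shift_large {l : Filter (ℕ × ℕ)}
    (hl : Tendsto (fun p : ℕ × ℕ => p.1) l atTop) {ψ : ℕ × ℕ → ℕ → ℝ} (i₀ : ℕ) (x : ℝ)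
    (hψ : Tendsto (fun p : ℕ × ℕ => gumbelB p.1 + gumbelA p.1 * x - ψ p i₀) l atBot) :
    Tendsto (fun p : ℕ × ℕ => ∏ i : Fin p.1, (gaussianReal 0 1).real
      (Set.Iic (gumbelB p.1 + gumbelA p.1 * x - ψ p i))) l (𝓝 0) := by
  have hcdf : Tendsto (fun z => (gaussianReal 0 1).real (Set.Iic z)) atBot (𝓝 0) := by
    refine (tendsto_cdf_atBot (gaussianReal 0 1)).congr fun z => ?_
    rw [cdf_eq_real]
  refine squeeze_zero' (Eventually.of_forall fun p =>
    Finset.prod_nonneg fun i _ => measureReal_nonneg) ?_ (hcdf.comp hψ)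
  filter_upwards [hl.eventually_gt_atTop i₀] with p hp
  rw [← Finset.mul_prod_erase _ _ (Finset.mem_univ (⟨i₀, hp⟩ : Fin p.1))]
  exact mul_le_of_le_one_right measureReal_nonneg
    (Finset.prod_le_one (fun i _ => measureReal_nonneg) fun i _ => measureReal_le_one)

end Limits

theorem theorem1 {Ω : Type*} [MeasurableSpace Ω] (P : Measure Ω) [IsProbabilityMeasure P]
    {K : ℕ} (ν : ℝ) (hν : 4 < ν)
    -- loadings and pricing errors
    (α : ℕ → ℝ) (β : ℕ → Fin K → ℝ)
    -- factors and errors, with their innovations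
    (f : ℤ → Ω → EuclideanSpace ℝ (Fin K)) (u : ℕ → ℤ → Ω → ℝ)
    {Sf : Type*} [MeasurableSpace Sf] (ηf : ℤ → Ω → Sf)
    {Su : ℕ → Type*} [∀ i, MeasurableSpace (Su i)] (ηu : (i : ℕ) → ℤ → Ω → Su i)
    -- the errors are decomposable Bernoulli shifts, uniformly over the units
    (au cu : ℝ) (hau : (ν - 1) / (ν - 2) < au)
    (hu : ∀ i, IsDecomposableShift P (ηu i) (u i) ν au cu)
    (M : ℝ≥0) (huM : ∀ i t, eLpNorm (u i t) (ENNReal.ofReal ν) P ≤ M)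
    (hu0 : ∀ i t, ∫ ω, u i t ω ∂P = 0)
    (σ : ℝ) (hσ : 0 < σ) (huσ : ∀ i t, σ ≤ ∫ ω, u i t ω ^ 2 ∂P)
    -- the factors are a decomposable Bernoulli shift with positive definite covariance matrix
    (af cf : ℝ) (haf : (ν - 1) / (ν - 2) < af)
    (hf : IsDecomposableShift P ηf f ν af cf)
    (hfV : ∀ t, (covMatrix P (f t)).PosDef)
    -- for each unit, the innovations of the factors and of the errors are jointly i.i.d. over time
    (hjoint : ∀ i, IsIIDSeq P (fun t ω => (ηf t ω, ηu i t ω)))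
    -- weak exogeneity
    (hexo : ∀ i t, ∫ ω, u i t ω • f t ω ∂P = 0)
    -- the relative rate of divergence: `N ≤ C T^{(ν/2 - 1)/2 - ε}`
    (ε : ℝ) (hε : 0 < ε) (C : ℝ)
    -- the added randomness: i.i.d. standard normal, independent of the sample
    (w : ℕ → Ω → ℝ) (hw_meas : ∀ i, Measurable (w i)) (hw_indep : iIndepFun w P)
    (hw_law : ∀ i, P.map (w i) = gaussianReal 0 1)
    (hw_sample : ∀ N T : ℕ,
      IndepFun (fun ω (i : Fin N) => w i ω) (sampleNT f u N T) P) :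
    ((∀ i, α i = 0) →
      ∀ᵐ ω ∂P, ∀ x : ℝ,
        Tendsto (fun p : ℕ × ℕ => condCDFStat P ν α β f u w p.1 p.2 x ω)
          (jointLimit ν ε C) (𝓝 (Real.exp (-Real.exp (-x))))) ∧
    ((∃ i, α i ≠ 0) →
      ∀ᵐ ω ∂P, ∀ x : ℝ,
        Tendsto (fun p : ℕ × ℕ => condCDFStat P ν α β f u w p.1 p.2 x ω)
          (jointLimit ν ε C) (𝓝 0)) := by
  have hν1 : 1 < (ν - 1) / (ν - 2) := by
    rw [one_lt_div (by linarith)]; linarith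
  have hest := ae_exists_estimator_bounds hν α β (hν1.trans hau) hu huM hu0 hσ huσ
    (hν1.trans haf) hf hfV hjoint hexo hε C
  have hcond := ae_condCDFStat_eq (P := P) ν α β hf.measurable (fun i => (hu i).measurable)
    hw_meas hw_indep hw_law hw_sample
  have hN := tendsto_fst_jointLimit ν ε C
  have hT := tendsto_snd_jointLimit ν ε C
  have hNT := eventually_le_jointLimit ν ε C
  refine ⟨fun hα => ?_, fun ⟨i₀, hi₀⟩ => ?_⟩
  · filter_upwards [hest, hcond] with ω ⟨B, s, hB, hs, hbd⟩ hω x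
    set ψ : ℕ × ℕ → ℕ → ℝ := fun p i => psiStat ν p.1 p.2 (fun t => f t ω)
      (returns α β (fun t => f t ω) fun i t => u i t ω) i with hψ
    have hsmall : ∀ ρ > 0, ∀ᶠ p in jointLimit ν ε C, ∀ i < p.1, ψ p i ≤ ρ * gumbelA p.1 := by
      intro ρ hρ
      have hlog := (tendsto_sqrt_log_mul_rpow_neg ν ε C (r := ε / 2) (by positivity)).const_mul
        ((B / s) ^ (ν / 2))
      rw [mul_zero] at hlog
      filter_upwards [hT.eventually hbd, hNT, hN.eventually_ge_atTop 1, hT.eventually_ge_atTop 1,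
        hlog.eventually_lt_const (show 0 < ρ * (1 / 2) by positivity),
        hN.eventually (tendsto_gumbelA_mul_sqrt.eventually_const_lt
          (show (1 / 2 : ℝ) < 1 by norm_num)),
        hN.eventually (tendsto_sqrt_two_log.eventually_gt_atTop 0)]
        with p hbp hle hN1 hT1 hlogp hap hsq i hi
      obtain ⟨halpha, hsB⟩ := hbp p.1 hN1 hle
      have ha := halpha i hi
      rw [hα i, sub_zero] at ha
      refine (psiStat_le hν hT1 hB hs ha hsB.1).trans (le_of_mul_le_mul_right ?_ hsq)
      nlinarith
    refine (tendsto_prod_normalCDF_of_shift_small hN (fun p i => psiStat_nonneg _ _ _ _ _ i)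
      hsmall x).congr' ?_
    filter_upwards [hN.eventually_ge_atTop 1, hN.eventually eventually_gumbelA_pos] with p hN1 ha
    exact (hω p.1 p.2 hN1 ha x).symm
  · filter_upwards [hest, hcond] with ω ⟨B, s, hB, hs, hbd⟩ hω x
    set ψ : ℕ × ℕ → ℕ → ℝ := fun p i => psiStat ν p.1 p.2 (fun t => f t ω)
      (returns α β (fun t => f t ω) fun i t => u i t ω) i with hψ
    have hαpos : 0 < |α i₀| := abs_pos.2 hi₀
    have hδ : 0 < (1 + ε) / ν := by positivity
    have herr : Tendsto (fun p : ℕ × ℕ => B * (p.2 : ℝ) ^ (-((1 + ε) / ν))) (jointLimit ν ε C)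
        (𝓝 0) := by
      simpa using ((tendsto_natCast_rpow_neg hδ).comp hT).const_mul B
    set κ : ℝ := (|α i₀| / 2 / max B 1) ^ (ν / 2) with hκ
    have hκ0 : 0 < κ := by positivity
    have hlog := tendsto_sqrt_log_mul_rpow_neg ν ε C (r := 1 / 2) (by norm_num)
    have hlower : ∀ᶠ p in jointLimit ν ε C,
        gumbelB p.1 + gumbelA p.1 * x - ψ p i₀ ≤ 1 - κ / 2 * (p.2 : ℝ) ^ (1 / 2 : ℝ) := by
      have hax : Tendsto (fun n => gumbelA n * x) atTop (𝓝 0) := by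
        simpa using tendsto_gumbelA.mul_const x
      filter_upwards [hT.eventually hbd, hNT, hN.eventually_ge_atTop 1, hT.eventually_ge_atTop 1,
        hN.eventually_gt_atTop i₀,
        hlog.eventually_lt_const (show 0 < κ / 4 by positivity),
        herr.eventually_lt_const (show 0 < |α i₀| / 2 by positivity),
        hN.eventually (hax.eventually_lt_const one_pos),
        hN.eventually (tendsto_gumbelB_div_sqrt.eventually_lt_const
          (show (1 : ℝ) < 2 by norm_num)),
        hN.eventually (tendsto_sqrt_two_log.eventually_gt_atTop 0)]
        with p hbp hle hN1 hT1 hi hlogp herrp haxp hbp' hsq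
      obtain ⟨halpha, hsB⟩ := hbp p.1 hN1 hle
      have ha := halpha i₀ hi
      have hT0 : (0 : ℝ) < p.2 := by exact_mod_cast hT1
      have habs : |α i₀| / 2 ≤ |alphaHat p.2 (fun t => f t ω)
          (returns α β (fun t => f t ω) (fun i t => u i t ω) i₀)| := by
        have h1 := abs_sub_abs_le_abs_sub (α i₀) (alphaHat p.2 (fun t => f t ω)
          (returns α β (fun t => f t ω) (fun i t => u i t ω) i₀))
        rw [abs_sub_comm (α i₀)] at h1
        linarith
      have hψlow : κ * (p.2 : ℝ) ^ (1 / 2 : ℝ) ≤ ψ p i₀ :=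
        le_psiStat hν hT1 (by positivity) habs (hs.trans_le hsB.1)
          (hsB.2.trans (le_max_left _ _))
      have hpos : 0 < (p.2 : ℝ) ^ (1 / 2 : ℝ) := by positivity
      have hsqT : √(2 * Real.log p.1) < κ / 4 * (p.2 : ℝ) ^ (1 / 2 : ℝ) := by
        rwa [Real.rpow_neg hT0.le, ← div_eq_mul_inv, div_lt_iff₀ hpos] at hlogp
      rw [div_lt_iff₀ hsq] at hbp'
      linarith
    have hbot : Tendsto (fun p : ℕ × ℕ => 1 - κ / 2 * (p.2 : ℝ) ^ (1 / 2 : ℝ))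
        (jointLimit ν ε C) atBot := by
      have h1 : Tendsto (fun p : ℕ × ℕ => κ / 2 * (p.2 : ℝ) ^ (1 / 2 : ℝ)) (jointLimit ν ε C)
          atTop :=
        Tendsto.const_mul_atTop (by positivity) ((tendsto_rpow_atTop (by norm_num)).comp
          (tendsto_natCast_atTop_atTop.comp hT))
      exact tendsto_atBot_add_const_left _ 1 (tendsto_neg_atTop_atBot.comp h1)
    refine (tendsto_prod_normalCDF_of_shift_large hN i₀ x
      (tendsto_atBot_mono' _ hlower hbot)).congr' ?_
    filter_upwards [hN.eventually_ge_atTop 1, hN.eventually eventually_gumbelA_pos] with p hN1 ha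
    exact (hω p.1 p.2 hN1 ha x).symm
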